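/- Let $H_1$ be the 3-dimensional Heisenberg group, with basis $X,Y,Z$ of its Lie algebra such that $[X,Y]=Z$ is the only non-trivial bracket, and let $\mathfrak v_0=\mathrm{Span}\{X,Y\}$. For an integer $r\ge 1$ let $\Gamma_r=\langle \exp(rX),\exp(Y),\exp(Z)\rangle$. For $\tilde A\in GL_2(\mathbb R)$ let $\|\cdot\|_A$ be the Euclidean norm on $\mathfrak v_0$ with orthonormal basis $\tilde AX,\tilde AY$, let $\widetilde{dist}_A$ be the associated left-invariant sub-Riemannian distance on $H_1$, and let $dist_A$ be the quotient distance on $\Gamma_r\backslash H_1$. Let $V=V(r,A)$ be the total Popp volume of $\Gamma_r\backslash H_1$, where Popp's volume is the volume $\|Z\|_2\,|\det\tilde A|^{-1}\,|X^*\wedge Y^*\wedge Z^*|$ defined by the norm $\|z\|_2=\min\{\|U\|_A\|W\|_A : U,W\in\mathfrak v_0,\ [U,W]=z\}$ on $\mathbb RZ\cong\mathfrak h_1/\mathfrak v_0$. Let $$sys(\Gamma_r\backslash H_1,dist_A)=\inf\{length(c) : c \text{ a closed curve},\ [c]\in H_1(\Gamma_r\backslash H_1,\mathbb Z)\setminus\{0\}\}$$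 (here $H_1(\cdot,\mathbb Z)$ is singular homology). Let $L_r=r\mathbb ZX\oplus\mathbb ZY$ be the projection of $\Gamma_r$ to $\mathfrak v_0$, let $s_1(r,A)=\min\{\|U\|_A : U\in L_r\setminus\{0\}\}$ (the systole of the flat base torus $L_r\backslash\mathfrak v_0$), let $\mathrm{area}(r,A)$ be the Riemannian area of that torus, and let $s_2(A)=\min\{\widetilde{dist}_A(e,\exp(pZ)) : p\in\mathbb Z\setminus\{0\}\}$ (the systole of the circle fiber). Put $\tilde C_2=\sqrt{2/\sqrt3}$. Then the following hold. (1) Suppose $r\le 4\pi/\tilde C_2^{2}$ and put $C_r=\tilde C_2\,r^{1/4}$. For every $\tilde A$ we have $sys(\Gamma_r\backslash H_1,dist_A)=s_1(r,A)$ and $sys(\Gamma_r\backslash H_1,dist_A)\le C_r V^{1/4}$. Equality holds if and only if $s_1(r,A)=\tilde C_2\,\mathrm{area}(r,A)^{1/2}$, that is, the base torus attains equality in the systolic inequality for flat 2-tori; this happens if and only if the base torus is hexagonal, meaning that $L_r$ has a $\mathbb Z$-basis $u,v$ with $\|u\|_A=\|v\|_A=\|u-v\|_A$. Equality is attained for some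 $\tilde A$, so $C_r$ is sharp. (2) Suppose $r\ge 4\pi/\tilde C_2^{2}$ and put $C_r=2\sqrt\pi/r^{1/4}$. For every $\tilde A$ we have $sys(\Gamma_r\backslash H_1,dist_A)\le C_r V^{1/4}$. Equality holds if and only if $s_1(r,A)\ge s_2(A)$, and this happens if and only if $sys(\Gamma_r\backslash H_1,dist_A)=s_2(A)$. Equality is attained for some $\tilde A$, so $C_r$ is sharp. -/

import Mathlib

open MeasureTheory Set
open scoped ENNReal Matrix

noncomputable section

namespace SubRiem

/-! ## First integral singular homology and the systole of a length space -/

section Homology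

variable (X : Type*) [TopologicalSpace X]

/-- Singular `0`-chains. -/
abbrev Chain0 : Type _ := X →₀ ℤ

/-- Singular `1`-chains; a singular `1`-simplex is a continuous map `[0,1] → X`. -/
abbrev Chain1 : Type _ := C(unitInterval, X) →₀ ℤ

/-- Singular `2`-chains; a singular `2`-simplex is a continuous map from the standard triangle. -/
abbrev Chain2 : Type _ := C(stdSimplex ℝ (Fin 3), X) →₀ ℤ

/-- The affine edge `t ↦ (1 - t) eᵢ + t eⱼ` of the standard triangle. -/
def edge (i j : Fin 3) : C(unitInterval, stdSimplex ℝ (Fin 3)) where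
  toFun t := ⟨Pi.single i (1 - (t : ℝ)) + Pi.single j (t : ℝ), by
    constructor
    · intro k
      refine add_nonneg ?_ ?_
      · by_cases h : k = i
        · subst h; simpa using t.2.2
        · simp [h]
      · by_cases h : k = j
        · subst h; simpa using t.2.1
        · simp [h]
    · simp [Finset.sum_add_distrib]⟩
  continuous_toFun := by
    refine Continuous.subtype_mk ?_ _
    refine Continuous.add ?_ ?_
    · exact (continuous_single (A := fun _ : Fin 3 => ℝ) i).comp (by fun_prop)
    · exact (continuous_single (A := fun _ : Fin 3 => ℝ) j).comp (by fun_prop)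

variable {X}

/-- `∂₁ c = c(1) - c(0)`. -/
def boundary1 : Chain1 X →ₗ[ℤ] Chain0 X :=
  Finsupp.linearCombination ℤ fun c => Finsupp.single (c 1) 1 - Finsupp.single (c 0) 1

/-- `∂₂ σ = σ|[e₁,e₂] - σ|[e₀,e₂] + σ|[e₀,e₁]`. -/
def boundary2 : Chain2 X →ₗ[ℤ] Chain1 X :=
  Finsupp.linearCombination ℤ fun σ =>
    Finsupp.single (σ.comp (edge 1 2)) 1 - Finsupp.single (σ.comp (edge 0 2)) 1
      + Finsupp.single (σ.comp (edge 0 1)) 1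

variable (X) in
/-- The singular homology group `H₁(X, ℤ) = ker ∂₁ / im ∂₂`. -/
abbrev H1 : Type _ :=
  LinearMap.ker (boundary1 (X := X)) ⧸
    (LinearMap.range (boundary2 (X := X))).submoduleOf (LinearMap.ker (boundary1 (X := X)))

/-- The class in `H₁(X, ℤ)` of a closed curve. -/
def loopClass (c : C(unitInterval, X)) (hc : c 0 = c 1) : H1 X :=
  Submodule.Quotient.mk ⟨Finsupp.single c 1, by simp [boundary1, hc]⟩

/-- Length of a curve with respect to a distance `d`: the supremum of the polygonal sums. -/
def curveLength (d : X → X → ℝ≥0∞) (c : unitInterval → X) : ℝ≥0∞ :=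
  ⨆ p : ℕ × {u : ℕ → unitInterval // Monotone u},
    ∑ i ∈ Finset.range p.1, d (c (p.2.1 (i + 1))) (c (p.2.1 i))

/-- The systole `inf {length(c) | [c] ∈ H₁(X, ℤ) \ {0}}`. -/
def systole (d : X → X → ℝ≥0∞) : ℝ≥0∞ :=
  ⨅ (c : C(unitInterval, X)) (hc : c 0 = c 1) (_ : loopClass c hc ≠ 0), curveLength d c

end Homology

/-! ## The Heisenberg group, its lattices and left invariant structures -/

/-- The horizontal plane `𝔳₀ = Span{X, Y}`, in the basis `X, Y`. -/
abbrev V0 : Type := Fin 2 → ℝ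

/-- `[U, V] = ω(U, V) Z` for `U, V ∈ 𝔳₀`; in particular `[X, Y] = Z`. -/
def omega (u v : V0) : ℝ := u 0 * v 1 - u 1 * v 0

/-- The three dimensional Heisenberg group in exponential coordinates:
`(u, z)` is `exp(u₀ X + u₁ Y + z Z)`. -/
def Heis : Type := V0 × ℝ

namespace Heis

instance : TopologicalSpace Heis := inferInstanceAs (TopologicalSpace (V0 × ℝ))

instance : MeasureSpace Heis := inferInstanceAs (MeasureSpace (V0 × ℝ))

/-- The group law given by the Baker--Campbell--Hausdorff formula. -/
instance : Mul Heis := ⟨fun p q => (p.1 + q.1, p.2 + q.2 + omega p.1 q.1 / 2)⟩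

instance : One Heis := ⟨((0 : V0), (0 : ℝ))⟩

instance : Inv Heis := ⟨fun p => (-p.1, -p.2)⟩

@[simp] theorem fst_mul (p q : Heis) : (p * q).1 = p.1 + q.1 := rfl

@[simp] theorem snd_mul (p q : Heis) : (p * q).2 = p.2 + q.2 + omega p.1 q.1 / 2 := rfl

@[simp] theorem fst_one : (1 : Heis).1 = 0 := rfl

@[simp] theorem snd_one : (1 : Heis).2 = 0 := rfl

@[simp] theorem fst_inv (p : Heis) : (p⁻¹).1 = -p.1 := rfl

@[simp] theorem snd_inv (p : Heis) : (p⁻¹).2 = -p.2 := rfl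

instance : Group Heis :=
  Group.ofLeftAxioms
    (fun p q s => Prod.ext (add_assoc _ _ _) (by simp [omega]; ring))
    (fun p => Prod.ext (zero_add _) (by simp [omega]))
    (fun p => Prod.ext (neg_add_cancel _) (by simp [omega]; ring))

end Heis

/-- The exponential map, `exp(u₀ X + u₁ Y + z Z)`. -/
def hexp (u : V0) (z : ℝ) : Heis := (u, z)

/-- The lattice `Γ_r` generated by `exp(r X), exp(Y), exp(Z)`. -/
def Gam (r : ℕ) : Subgroup Heis :=
  Subgroup.closure {hexp ![(r : ℝ), 0] 0, hexp ![0, 1] 0, hexp 0 1}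

/-- The Heisenberg manifold `Γ_r \ H₁` (orbit space of left multiplication), with the quotient
topology. -/
abbrev HeisMfd (r : ℕ) : Type := MulAction.orbitRel.Quotient (Gam r) Heis

/-- The norm of the inner product on `𝔳₀` with orthonormal basis `A X, A Y`. -/
def normA (A : GL (Fin 2) ℝ) (u : V0) : ℝ :=
  ‖WithLp.toLp 2 (((A⁻¹ : GL (Fin 2) ℝ) : Matrix (Fin 2) (Fin 2) ℝ) *ᵥ u)‖

/-- The differential of left translation by `p` applied to `U ∈ 𝔳₀`, in exponential coordinates. -/
def leftTransport (p : Heis) (U : V0) : V0 × ℝ := (U, omega p.1 U / 2)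

theorem hasDerivAt_leftTransport (p : Heis) (U : V0) :
    HasDerivAt (fun s : ℝ => (show V0 × ℝ from p * hexp (s • U) 0)) (leftTransport p U) 0 := by
  have h : (fun s : ℝ => (show V0 × ℝ from p * hexp (s • U) 0))
      = fun s : ℝ => (show V0 × ℝ from p) + s • leftTransport p U := by
    funext s
    refine Prod.ext rfl ?_
    change p.2 + 0 + omega p.1 (s • U) / 2 = p.2 + s * (omega p.1 U / 2)
    simp only [omega, Pi.smul_apply, smul_eq_mul]
    ring
  rw [h]
  simpa using ((hasDerivAt_id (0 : ℝ)).smul_const (leftTransport p U)).const_add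
    (show V0 × ℝ from p)

/-- Admissible curves: absolutely continuous on `[0,1]`, with velocity a.e. in the left invariant
distribution spanned by `𝔳₀`. -/
def Admissible (c : ℝ → Heis) : Prop :=
  AbsolutelyContinuousOnInterval (fun t => (c t).1) 0 1 ∧
  AbsolutelyContinuousOnInterval (fun t => (c t).2) 0 1 ∧
  ∀ᵐ t ∂(volume.restrict (Icc (0 : ℝ) 1)), ∃ U : V0,
    (deriv (fun s => (c s).1) t, deriv (fun s => (c s).2) t) = leftTransport (c t) U

/-- Sub-Riemannian length. The `𝔳₀`-coordinate of the velocity of an admissible curve is its left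
trivialization, so the integrand is `√(g(ċ, ċ))`. -/
def srLength (A : GL (Fin 2) ℝ) (c : ℝ → Heis) : ℝ≥0∞ :=
  ∫⁻ t in Icc (0 : ℝ) 1, ENNReal.ofReal (normA A (deriv (fun s => (c s).1) t))

/-- The sub-Riemannian distance on the Heisenberg group. -/
def srDist (A : GL (Fin 2) ℝ) (p q : Heis) : ℝ≥0∞ :=
  ⨅ (c : ℝ → Heis) (_ : Admissible c) (_ : c 0 = p) (_ : c 1 = q), srLength A c

/-- The quotient distance on `Γ_r \ H₁`. -/
def quotDist (r : ℕ) (A : GL (Fin 2) ℝ) (a b : HeisMfd r) : ℝ≥0∞ :=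
  ⨅ (p : Heis) (_ : (Quotient.mk _ p : HeisMfd r) = a)
    (q : Heis) (_ : (Quotient.mk _ q : HeisMfd r) = b), srDist A p q

/-- The systole of `(Γ_r \ H₁, dist_A)`. -/
def heisSystole (r : ℕ) (A : GL (Fin 2) ℝ) : ℝ≥0∞ := systole (quotDist r A)

/-! ## Popp's volume -/

/-- The norm `‖zZ‖₂ = min {‖U‖ ‖V‖ | [U, V] = zZ mod 𝔳₀}` on `𝔥 / 𝔳₀ = ℝ Z`. -/
def norm2 (A : GL (Fin 2) ℝ) (z : ℝ) : ℝ :=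
  sInf {t : ℝ | ∃ U V : V0, omega U V = z ∧ t = normA A U * normA A V}

/-- Popp's volume, as a measure on the Heisenberg group. An orthonormal basis of the
nilpotentization is `A X, A Y, ‖Z‖₂⁻¹ Z`, and the wedge of its dual basis is
`‖Z‖₂ (det A)⁻¹ X* ∧ Y* ∧ Z*`; in exponential coordinates `X* ∧ Y* ∧ Z*` is Lebesgue measure. -/
def popp (A : GL (Fin 2) ℝ) : Measure Heis :=
  ENNReal.ofReal (norm2 A 1 * |(A : Matrix (Fin 2) (Fin 2) ℝ).det|⁻¹) • volume

/-- The total Popp volume of `Γ_r \ H₁`: the Popp volume of a fundamental domain. -/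
def poppVol (r : ℕ) (A : GL (Fin 2) ℝ) : ℝ≥0∞ := covolume (Gam r) Heis (popp A)

/-! ## The base torus and the circle fiber -/

/-- The projection `P₀(Γ_r)` of the lattice to `𝔳₀`. -/
def baseLattice (r : ℕ) : AddSubgroup V0 where
  carrier := {u | ∃ g ∈ Gam r, g.1 = u}
  add_mem' := by
    rintro _ _ ⟨g, hg, rfl⟩ ⟨h, hh, rfl⟩
    exact ⟨g * h, mul_mem hg hh, rfl⟩
  zero_mem' := ⟨1, one_mem _, rfl⟩
  neg_mem' := by
    rintro _ ⟨g, hg, rfl⟩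
    exact ⟨g⁻¹, inv_mem hg, rfl⟩

/-- `s₁(r, A)`, the systole of the flat base torus `P₀(Γ_r) \ 𝔳₀`. -/
def s1 (r : ℕ) (A : GL (Fin 2) ℝ) : ℝ≥0∞ :=
  ⨅ (u : V0) (_ : u ∈ baseLattice r) (_ : u ≠ 0), ENNReal.ofReal (normA A u)

/-- `s₂(A)`, the systole of the circle fiber. -/
def s2 (A : GL (Fin 2) ℝ) : ℝ≥0∞ :=
  ⨅ (p : ℤ) (_ : p ≠ 0), srDist A 1 (hexp 0 (p : ℝ))

/-- The Riemannian area of the flat base torus. -/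
def torusArea (r : ℕ) (A : GL (Fin 2) ℝ) : ℝ≥0∞ :=
  addCovolume (baseLattice r) V0
    (ENNReal.ofReal |(A : Matrix (Fin 2) (Fin 2) ℝ).det|⁻¹ • (volume : Measure V0))

/-- The flat base torus is hexagonal: its lattice is spanned by two sides of an equilateral
triangle. -/
def IsHexagonal (r : ℕ) (A : GL (Fin 2) ℝ) : Prop :=
  ∃ u v : V0, AddSubgroup.closure {u, v} = baseLattice r ∧
    normA A u = normA A v ∧ normA A (u - v) = normA A u

/-- The optimal constant in the systolic inequality of flat `2`-tori. -/
def Ctilde2 : ℝ := √(2 / √3)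

end SubRiem

end

open SubRiem

/-! Write D = |det A|. The proof compares two explicit lengths with the systole.

A closed curve in the quotient lifts to a curve in the Heisenberg group whose ends differ by some g
in Γ_r. If g has a nonzero horizontal part u, the curve is at least as long as the lattice vector u,
hence at least s₁. If g = exp(kZ), then k ≠ 0, since otherwise the lift is a closed curve in a
vector space and its image bounds a cone. The height gained is then the area enclosed by the
projected curve, and the isoperimetric inequality bounds the length below by 2√(π/D), which equals
s₂ because lifted circles attain it. So the systole is at least min(s₁, s₂) (`min_le_heisSystole`).
The competing curves are merely continuous and of finite length for the quotient distance, so this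
argument is run on fine subdivisions, with an isoperimetric inequality for polygons
(`polygon_isoperimetric`, proved by a calibration) and vertical errors of smaller order
(`exists_subdivision`).

Conversely, the systole is at most s₁, since every nonzero lattice vector is realised by a closed
horizontal line that is visible in the homology of the base torus. It is at most s₂ once r ≥ 2:
commutators in Γ_r contribute only multiples of rZ, so the fibre class survives modulo r
(`centralHeight`).

The volumes are V = r/D² and area = r/D, so s₂ = 2√π r^(-1/4) V^(1/4) identically, whereas s₁ ≤ C̃₂
area^(1/2) = C̃₂ r^(1/4) V^(1/4), with equality exactly for hexagonal lattices (Gauss reduction).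
Both bounds scale as D^(-1/2), so their order depends on r alone and changes at r = 4π/C̃₂². Below
this value s₁ ≤ s₂ always; above it, hexagonal tori satisfy s₂ ≤ s₁. -/

noncomputable section

namespace SubRiem

/-! ## The plane, its norms and the symplectic form -/

/-- The linear isometry `U ↦ A⁻¹ U` of `(𝔳₀, ‖·‖_A)` onto the Euclidean plane. -/
def toEuc (A : GL (Fin 2) ℝ) : V0 →L[ℝ] EuclideanSpace ℝ (Fin 2) :=
  LinearMap.toContinuousLinearMap
    ((WithLp.linearEquiv 2 ℝ V0).symm.toLinearMap ∘ₗ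
      Matrix.mulVecLin ((A⁻¹ : GL (Fin 2) ℝ) : Matrix (Fin 2) (Fin 2) ℝ))

theorem normA_eq (A : GL (Fin 2) ℝ) (u : V0) : normA A u = ‖toEuc A u‖ := rfl

theorem toEuc_apply (A : GL (Fin 2) ℝ) (u : V0) (i : Fin 2) :
    toEuc A u i = (((A⁻¹ : GL (Fin 2) ℝ) : Matrix (Fin 2) (Fin 2) ℝ) *ᵥ u) i := rfl

theorem toEuc_mulVec (A : GL (Fin 2) ℝ) (w : V0) :
    toEuc A ((A : Matrix (Fin 2) (Fin 2) ℝ) *ᵥ w) = WithLp.toLp 2 w := by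
  have h : ((A⁻¹ : GL (Fin 2) ℝ) : Matrix (Fin 2) (Fin 2) ℝ) * (A : Matrix (Fin 2) (Fin 2) ℝ) = 1 :=
    by rw [← Units.val_mul, inv_mul_cancel, Units.val_one]
  ext i
  rw [toEuc_apply, Matrix.mulVec_mulVec, h, Matrix.one_mulVec]

theorem mulVec_toEuc (A : GL (Fin 2) ℝ) (u : V0) :
    (A : Matrix (Fin 2) (Fin 2) ℝ) *ᵥ (fun i => toEuc A u i) = u := by
  have h : (A : Matrix (Fin 2) (Fin 2) ℝ) * ((A⁻¹ : GL (Fin 2) ℝ) : Matrix (Fin 2) (Fin 2) ℝ) = 1 :=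
    by rw [← Units.val_mul, mul_inv_cancel, Units.val_one]
  change (A : Matrix (Fin 2) (Fin 2) ℝ) *ᵥ
    (((A⁻¹ : GL (Fin 2) ℝ) : Matrix (Fin 2) (Fin 2) ℝ) *ᵥ u) = u
  rw [Matrix.mulVec_mulVec, h, Matrix.one_mulVec]

theorem normA_nonneg (A : GL (Fin 2) ℝ) (u : V0) : 0 ≤ normA A u := norm_nonneg _

theorem normA_smul (A : GL (Fin 2) ℝ) (t : ℝ) (u : V0) : normA A (t • u) = |t| * normA A u := by
  simp [normA_eq, norm_smul]

theorem normA_neg (A : GL (Fin 2) ℝ) (u : V0) : normA A (-u) = normA A u := by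
  simp [normA_eq]

theorem normA_zero (A : GL (Fin 2) ℝ) : normA A 0 = 0 := by simp [normA_eq]

theorem normA_add_le (A : GL (Fin 2) ℝ) (u w : V0) :
    normA A (u + w) ≤ normA A u + normA A w := by
  simpa [normA_eq] using norm_add_le (toEuc A u) (toEuc A w)

theorem normA_sub_comm (A : GL (Fin 2) ℝ) (u w : V0) : normA A (u - w) = normA A (w - u) := by
  simpa [normA_eq] using norm_sub_rev (toEuc A u) (toEuc A w)

theorem continuous_normA (A : GL (Fin 2) ℝ) : Continuous (normA A) := (toEuc A).continuous.norm

theorem toEuc_injective (A : GL (Fin 2) ℝ) : Function.Injective (toEuc A) := fun u w h => by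
  rw [← mulVec_toEuc A u, ← mulVec_toEuc A w, h]

theorem normA_eq_zero (A : GL (Fin 2) ℝ) {u : V0} : normA A u = 0 ↔ u = 0 := by
  rw [normA_eq, norm_eq_zero, map_eq_zero_iff _ (toEuc_injective A)]

theorem normA_pos (A : GL (Fin 2) ℝ) {u : V0} (hu : u ≠ 0) : 0 < normA A u :=
  lt_of_le_of_ne (normA_nonneg A u) fun h => hu ((normA_eq_zero A).1 h.symm)

theorem normA_sq (A : GL (Fin 2) ℝ) (u : V0) :
    normA A u ^ 2 = toEuc A u 0 ^ 2 + toEuc A u 1 ^ 2 := by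
  rw [normA_eq, EuclideanSpace.norm_sq_eq]
  simp

/-- `|det A|`, the area of the unit square of `‖·‖_A`. -/
def absDet (A : GL (Fin 2) ℝ) : ℝ := |(A : Matrix (Fin 2) (Fin 2) ℝ).det|

theorem det_ne_zero (A : GL (Fin 2) ℝ) : (A : Matrix (Fin 2) (Fin 2) ℝ).det ≠ 0 :=
  ((Matrix.isUnit_iff_isUnit_det _).1 A.isUnit).ne_zero

theorem absDet_pos (A : GL (Fin 2) ℝ) : 0 < absDet A := abs_pos.2 (det_ne_zero A)

theorem omega_mulVec (M : Matrix (Fin 2) (Fin 2) ℝ) (u w : V0) :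
    omega (M *ᵥ u) (M *ᵥ w) = M.det * omega u w := by
  simp [omega, Matrix.mulVec, dotProduct, Fin.sum_univ_two, Matrix.det_fin_two]
  ring

theorem omega_eq_det_mul (A : GL (Fin 2) ℝ) (u w : V0) :
    omega u w = (A : Matrix (Fin 2) (Fin 2) ℝ).det
      * omega (fun i => toEuc A u i) (fun i => toEuc A w i) := by
  rw [← omega_mulVec, mulVec_toEuc, mulVec_toEuc]

theorem omega_add_right (u v w : V0) : omega u (v + w) = omega u v + omega u w := by
  simp [omega]; ring

theorem omega_sub_right (u v w : V0) : omega u (v - w) = omega u v - omega u w := by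
  simp [omega]; ring

theorem omega_sub_left (u v w : V0) : omega (u - v) w = omega u w - omega v w := by
  simp [omega]; ring

theorem omega_smul_right (t : ℝ) (u w : V0) : omega u (t • w) = t * omega u w := by
  simp [omega]; ring

theorem omega_self (u : V0) : omega u u = 0 := by simp [omega]; ring

theorem continuous_omega : Continuous fun p : V0 × V0 => omega p.1 p.2 := by
  unfold omega; fun_prop

/-- Lagrange's identity. -/
theorem sq_omega_add_sq_inner (A : GL (Fin 2) ℝ) (u w : V0) :
    omega u w ^ 2 = absDet A ^ 2 * (normA A u ^ 2 * normA A w ^ 2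
      - inner ℝ (toEuc A u) (toEuc A w) ^ 2) := by
  rw [omega_eq_det_mul A, normA_sq, normA_sq, absDet, sq_abs]
  simp [omega, PiLp.inner_apply, Fin.sum_univ_two]
  ring

theorem abs_omega_le (A : GL (Fin 2) ℝ) (u w : V0) :
    |omega u w| ≤ absDet A * (normA A u * normA A w) := by
  have h0 := absDet_pos A
  have h1 := normA_nonneg A u
  have h2 := normA_nonneg A w
  refine abs_le_of_sq_le_sq ?_ (by positivity)
  rw [sq_omega_add_sq_inner A, mul_pow, mul_pow]
  have := sq_nonneg (inner ℝ (toEuc A u) (toEuc A w))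
  gcongr
  linarith

/-- Up to sign, the coordinates of u are the values of `omega u` on the standard basis, so
`abs_omega_le` controls them. This is what makes sets of short lattice vectors finite. -/
theorem exists_mul_abs_le_normA (A : GL (Fin 2) ℝ) :
    ∃ κ > 0, ∀ (u : V0) (i : Fin 2), κ * |u i| ≤ normA A u := by
  have h0 := absDet_pos A
  set M := normA A ![1, 0] + normA A ![0, 1] + 1
  have hM1 : normA A ![1, 0] ≤ M := by have := normA_nonneg A ![0, 1]; simp only [M]; linarith
  have hM2 : normA A ![0, 1] ≤ M := by have := normA_nonneg A ![1, 0]; simp only [M]; linarith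
  have hM : 0 < M := by
    have := normA_nonneg A ![0, 1]; have := normA_nonneg A ![1, 0]; simp only [M]; linarith
  refine ⟨(absDet A * M)⁻¹, by positivity, fun u i => ?_⟩
  rw [inv_mul_le_iff₀ (by positivity), mul_assoc, mul_comm M]
  have hu := normA_nonneg A u
  fin_cases i
  · have := abs_omega_le A u ![0, 1]
    simp only [omega, Matrix.cons_val_zero, Matrix.cons_val_one, mul_one, mul_zero, sub_zero] at this
    refine this.trans ?_
    gcongr
  · have := abs_omega_le A u ![1, 0]
    simp only [omega, Matrix.cons_val_zero, Matrix.cons_val_one, mul_one, mul_zero, zero_sub,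
      abs_neg] at this
    refine this.trans ?_
    gcongr

/-- Lagrange's identity gives the lower bound; an A-orthogonal pair spanning symplectic area 1
attains it. -/
theorem norm2_one (A : GL (Fin 2) ℝ) : norm2 A 1 = (absDet A)⁻¹ := by
  have h0 := absDet_pos A
  have hd := det_ne_zero A
  refine IsLeast.csInf_eq ⟨?_, ?_⟩
  · refine ⟨(A : Matrix (Fin 2) (Fin 2) ℝ) *ᵥ ![1, 0], (A : Matrix (Fin 2) (Fin 2) ℝ) *ᵥ
      ![0, (A : Matrix (Fin 2) (Fin 2) ℝ).det⁻¹], ?_, ?_⟩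
    · rw [omega_mulVec]; simp [omega, hd]
    · rw [normA_eq, normA_eq, toEuc_mulVec, toEuc_mulVec, EuclideanSpace.norm_eq,
        EuclideanSpace.norm_eq]
      simp [Fin.sum_univ_two, absDet, Real.sqrt_sq_eq_abs]
  · rintro t ⟨U, W, h, rfl⟩
    have := abs_omega_le A U W
    rw [h, abs_one] at this
    rwa [inv_le_iff_one_le_mul₀' h0]

/-! ## The lattices -/

theorem Heis.ext' {p q : Heis} (h1 : p.1 = q.1) (h2 : p.2 = q.2) : p = q := Prod.ext h1 h2

/-- The elements of `Γ_r` in coordinates. -/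
def latticePt (r : ℕ) (a b c : ℤ) : Heis :=
  hexp ![r * a, b] (c + r * a * b / 2)

@[simp] theorem fst_hexp (u : V0) (z : ℝ) : (hexp u z).1 = u := rfl

@[simp] theorem snd_hexp (u : V0) (z : ℝ) : (hexp u z).2 = z := rfl

@[simp] theorem fst_latticePt (r : ℕ) (a b c : ℤ) : (latticePt r a b c).1 = ![(r : ℝ) * a, (b : ℝ)] :=
  rfl

@[simp] theorem snd_latticePt (r : ℕ) (a b c : ℤ) :
    (latticePt r a b c).2 = c + r * a * b / 2 := rfl

/-- `latticePt r a b c` is exp(raX) exp(bY) exp(cZ). Moving exp(ra'X) to the left past exp(bY) costs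
the commutator term -ra'b, always a multiple of r. -/
theorem latticePt_mul (r : ℕ) (a b c a' b' c' : ℤ) :
    latticePt r a b c * latticePt r a' b' c'
      = latticePt r (a + a') (b + b') (c + c' - r * a' * b) := by
  refine Heis.ext' ?_ ?_
  · simp [mul_add]
  · simp [omega]
    ring

theorem latticePt_zero (r : ℕ) : latticePt r 0 0 0 = 1 := Heis.ext' (by simp) (by simp)

theorem latticePt_inv (r : ℕ) (a b c : ℤ) :
    (latticePt r a b c)⁻¹ = latticePt r (-a) (-b) (-c - r * a * b) := by
  rw [inv_eq_iff_mul_eq_one, latticePt_mul, ← latticePt_zero r]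
  congr 1 <;> ring

theorem mem_of_map_add (S : Subgroup Heis) (f : ℤ → Heis) (hf : ∀ m n, f (m + n) = f m * f n)
    (h1 : f 1 ∈ S) (n : ℤ) : f n ∈ S := by
  have h0 : f 0 = 1 := by simpa using hf 0 0
  induction n with
  | zero => rw [h0]; exact one_mem S
  | succ k ih => rw [hf]; exact mul_mem ih h1
  | pred k ih =>
    have := hf (-(k : ℤ) - 1) 1
    rw [sub_add_cancel] at this
    rw [← mul_inv_eq_iff_eq_mul] at this
    rw [← this]
    exact mul_mem ih (inv_mem h1)

theorem mem_Gam {r : ℕ} {g : Heis} : g ∈ Gam r ↔ ∃ a b c : ℤ, g = latticePt r a b c := by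
  have hX (n : ℤ) : latticePt r n 0 0 ∈ Gam r :=
    mem_of_map_add _ (fun n => latticePt r n 0 0) (by simp [latticePt_mul])
      (Subgroup.subset_closure (by simp [latticePt])) n
  have hY (n : ℤ) : latticePt r 0 n 0 ∈ Gam r :=
    mem_of_map_add _ (fun n => latticePt r 0 n 0) (by simp [latticePt_mul])
      (Subgroup.subset_closure (by simp [latticePt])) n
  have hZ (n : ℤ) : latticePt r 0 0 n ∈ Gam r :=
    mem_of_map_add _ (fun n => latticePt r 0 0 n) (by simp [latticePt_mul])
      (Subgroup.subset_closure (by right; right; exact Heis.ext' (by simp) (by simp))) n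
  constructor
  · intro hg
    induction hg using Subgroup.closure_induction with
    | mem x hx =>
      rcases hx with rfl | rfl | rfl
      · exact ⟨1, 0, 0, by simp [latticePt]⟩
      · exact ⟨0, 1, 0, by simp [latticePt]⟩
      · exact ⟨0, 0, 1, Heis.ext' (by ext i; fin_cases i <;> simp) (by simp)⟩
    | one => exact ⟨0, 0, 0, (latticePt_zero r).symm⟩
    | mul x y _ _ hx hy =>
      obtain ⟨a, b, c, rfl⟩ := hx
      obtain ⟨a', b', c', rfl⟩ := hy
      exact ⟨_, _, _, latticePt_mul ..⟩
    | inv x _ hx =>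
      obtain ⟨a, b, c, rfl⟩ := hx
      exact ⟨_, _, _, latticePt_inv ..⟩
  · rintro ⟨a, b, c, rfl⟩
    have := mul_mem (mul_mem (hX a) (hY b)) (hZ c)
    simpa [latticePt_mul] using this

theorem mem_baseLattice {r : ℕ} {u : V0} :
    u ∈ baseLattice r ↔ ∃ a b : ℤ, u = ![(r : ℝ) * a, (b : ℝ)] := by
  constructor
  · rintro ⟨g, hg, rfl⟩
    obtain ⟨a, b, c, rfl⟩ := mem_Gam.1 hg
    exact ⟨a, b, rfl⟩
  · rintro ⟨a, b, rfl⟩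
    exact ⟨latticePt r a b 0, mem_Gam.2 ⟨_, _, _, rfl⟩, rfl⟩

theorem fst_mem_baseLattice {r : ℕ} {g : Heis} (hg : g ∈ Gam r) : g.1 ∈ baseLattice r :=
  ⟨g, hg, rfl⟩

theorem exists_eq_hexp_of_fst_eq_zero {r : ℕ} (hr : 0 < r) {g : Heis} (hg : g ∈ Gam r)
    (h : g.1 = 0) : ∃ c : ℤ, g = hexp 0 c := by
  obtain ⟨a, b, c, rfl⟩ := mem_Gam.1 hg
  have h0 := congrFun h 0
  have h1 := congrFun h 1
  simp [hr.ne'] at h0 h1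
  exact ⟨c, Heis.ext' h (by simp [h0])⟩

/-! ## The isoperimetric inequality for polygons -/

/-- The solution of the Riccati equation `c α' = -(α² + 1/16)` on `(0, 4πc)`. -/
def riccati (c θ : ℝ) : ℝ := Real.cos (θ / (4 * c)) / Real.sin (θ / (4 * c)) / 4

theorem hasDerivAt_riccati {c θ : ℝ} (hc : 0 < c) (h0 : 0 < θ) (h1 : θ < 4 * c * Real.pi) :
    HasDerivAt (riccati c) (-(riccati c θ ^ 2 + 1 / 16) / c) θ := by
  have hs : Real.sin (θ / (4 * c)) ≠ 0 :=
    (Real.sin_pos_of_pos_of_lt_pi (by positivity)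
      (by rw [div_lt_iff₀ (by positivity)]; linarith)).ne'
  have hd : HasDerivAt (fun θ : ℝ => θ / (4 * c)) (1 / (4 * c)) θ :=
    (hasDerivAt_id θ).div_const _
  have h := ((hd.cos.div hd.sin hs).div_const 4)
  refine h.congr_deriv ?_
  unfold riccati
  have := Real.sin_sq_add_cos_sq (θ / (4 * c))
  field_simp
  ring_nf at this ⊢

/-- Cauchy–Schwarz followed by the inequality of means. The square that is expanded gets divided by
l, hence the separate case l = 0. -/
theorem mul_add_mul_le_of_sq_add_sq_le {a b p q l c : ℝ} (hc : 0 < c) (hl : 0 ≤ l)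
    (h : p ^ 2 + q ^ 2 ≤ l ^ 2) : a * p + b * q ≤ l * ((a ^ 2 + b ^ 2) / (4 * c) + c) := by
  rcases hl.eq_or_lt with rfl | hl
  · have hp : p = 0 := by nlinarith [sq_nonneg p, sq_nonneg q]
    have hq : q = 0 := by nlinarith [sq_nonneg p, sq_nonneg q]
    simp [hp, hq]
  · have h1 : 0 ≤ (l * a - 2 * c * p) ^ 2 + (l * b - 2 * c * q) ^ 2 := by positivity
    have h2 : 4 * c * l * (a * p + b * q) ≤ l ^ 2 * (a ^ 2 + b ^ 2) + 4 * c ^ 2 * l ^ 2 := by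
      nlinarith [mul_le_mul_of_nonneg_left h (by positivity : 0 ≤ 4 * c ^ 2)]
    have h3 : l * ((a ^ 2 + b ^ 2) / (4 * c) + c)
        = (l ^ 2 * (a ^ 2 + b ^ 2) + 4 * c ^ 2 * l ^ 2) / (4 * c * l) := by
      field_simp
    rw [h3, le_div_iff₀ (by positivity)]
    linarith

/-- One step of the calibration argument. -/
theorem riccati_step {c θ l x y p q : ℝ} (hc : 0 < c) (hθ : 0 < θ) (hl : 0 ≤ l)
    (hθl : θ + l < 4 * c * Real.pi) (h : p ^ 2 + q ^ 2 ≤ l ^ 2) :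
    riccati c (θ + l) * ((x + p) ^ 2 + (y + q) ^ 2) - riccati c θ * (x ^ 2 + y ^ 2)
      + (x * q - y * p) / 2 ≤ c * l := by
  -- The calibrated quantity α(θ)|w|² + (area swept) - c·(length) along the segment from w = (x, y)
  -- to w + (p, q). It is shown to be nonincreasing.
  set f : ℝ → ℝ := fun s => riccati c (θ + s * l) * ((x + s * p) ^ 2 + (y + s * q) ^ 2)
    + s * ((x * q - y * p) / 2) - s * (c * l) with hf
  have hder : ∀ s ∈ Icc (0 : ℝ) 1, ∃ f', HasDerivAt f f' s ∧ f' ≤ 0 := by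
    rintro s ⟨hs0, hs1⟩
    have hsl : s * l ≤ l := mul_le_of_le_one_left hl hs1
    have hsl0 : 0 ≤ s * l := mul_nonneg hs0 hl
    have hα := hasDerivAt_riccati hc (θ := θ + s * l) (by linarith) (by linarith)
    set α := riccati c (θ + s * l)
    have d1 : HasDerivAt (fun s : ℝ => θ + s * l) l s := by
      simpa using ((hasDerivAt_id s).mul_const l).const_add θ
    have d2 : HasDerivAt (fun s : ℝ => x + s * p) p s := by
      simpa using ((hasDerivAt_id s).mul_const p).const_add x
    have d3 : HasDerivAt (fun s : ℝ => y + s * q) q s := by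
      simpa using ((hasDerivAt_id s).mul_const q).const_add y
    have d4 := (((hα.comp s d1).mul ((d2.pow 2).add (d3.pow 2))).add
      ((hasDerivAt_id s).mul_const ((x * q - y * p) / 2))).sub
      ((hasDerivAt_id s).mul_const (c * l))
    refine ⟨_, d4, ?_⟩
    -- The vector (a, b) is 2αw + Jw/2 with J the quarter turn. As Jw is orthogonal to w, its square
    -- norm is 4(α² + 1/16)|w|², which is the term supplied by the Riccati equation.
    have key := mul_add_mul_le_of_sq_add_sq_le (a := 2 * α * (x + s * p) - (y + s * q) / 2)
      (b := 2 * α * (y + s * q) + (x + s * p) / 2) hc hl h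
    have e1 : (2 * α * (x + s * p) - (y + s * q) / 2) ^ 2
        + (2 * α * (y + s * q) + (x + s * p) / 2) ^ 2
        = 4 * ((α ^ 2 + 1 / 16) * ((x + s * p) ^ 2 + (y + s * q) ^ 2)) := by ring
    rw [e1, mul_div_mul_left _ _ (by norm_num : (4 : ℝ) ≠ 0)] at key
    have e2 : -(α ^ 2 + 1 / 16) / c * l * ((x + s * p) ^ 2 + (y + s * q) ^ 2)
        = - (l * ((α ^ 2 + 1 / 16) * ((x + s * p) ^ 2 + (y + s * q) ^ 2) / c)) := by
      field_simp
    have goal : -(α ^ 2 + 1 / 16) / c * l * ((x + s * p) ^ 2 + (y + s * q) ^ 2)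
        + α * (2 * (x + s * p) * p + 2 * (y + s * q) * q) + (x * q - y * p) / 2 - c * l ≤ 0 := by
      rw [e2]
      linarith
    refine le_of_eq_of_le ?_ goal
    simp only [Pi.add_apply, Pi.pow_apply, Function.comp_apply, Nat.cast_ofNat, one_mul,
      Nat.add_one_sub_one, pow_one, α]
  have hanti : AntitoneOn f (Icc 0 1) := by
    refine antitoneOn_of_deriv_nonpos (convex_Icc 0 1) ?_ ?_ ?_
    · intro s hs
      obtain ⟨f', h', -⟩ := hder s hs
      exact h'.continuousAt.continuousWithinAt
    · intro s hs
      obtain ⟨f', h', -⟩ := hder s (interior_subset hs)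
      exact h'.differentiableAt.differentiableWithinAt
    · intro s hs
      obtain ⟨f', h', h''⟩ := hder s (interior_subset hs)
      rw [h'.deriv]
      exact h''
  have := hanti (left_mem_Icc.2 zero_le_one) (right_mem_Icc.2 zero_le_one) zero_le_one
  simp only [hf, one_mul, zero_mul, add_zero, sub_zero] at this
  linarith

/-- The isoperimetric inequality for closed polygons in the Euclidean plane. -/
theorem polygon_isoperimetric (n : ℕ) (x y l : ℕ → ℝ) (hx0 : x 0 = 0) (hy0 : y 0 = 0)
    (hxn : x n = 0) (hyn : y n = 0) (hl : ∀ i, 0 ≤ l i)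
    (h : ∀ i < n, (x (i + 1) - x i) ^ 2 + (y (i + 1) - y i) ^ 2 ≤ l i ^ 2) :
    ∑ i ∈ Finset.range n, (x i * y (i + 1) - y i * x (i + 1)) / 2
      ≤ (∑ i ∈ Finset.range n, l i) ^ 2 / (4 * Real.pi) := by
  set L := ∑ i ∈ Finset.range n, l i
  have hL : 0 ≤ L := Finset.sum_nonneg fun i _ => hl i
  have hpi := Real.pi_pos
  -- `riccati c` is singular at 0 and at 4πc. The parameter therefore starts at ε, and c is chosen
  -- with 4πc = L + 2ε, so that ε + L stays below the second pole. At both ends of the polygon w = 0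
  -- and the Riccati term vanishes.
  have main : ∀ ε > 0, ∑ i ∈ Finset.range n, (x i * y (i + 1) - y i * x (i + 1)) / 2
      ≤ (L + 2 * ε) / (4 * Real.pi) * L := by
    intro ε hε
    set c := (L + 2 * ε) / (4 * Real.pi) with hc
    have hc0 : 0 < c := by positivity
    have hcpi : 4 * c * Real.pi = L + 2 * ε := by rw [hc]; field_simp
    have hmono : ∀ m ≤ n, ∑ i ∈ Finset.range m, l i ≤ L := fun m hm =>
      Finset.sum_le_sum_of_subset_of_nonneg (Finset.range_subset_range.2 hm) fun i _ _ => hl i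
    have ind : ∀ m ≤ n, riccati c (ε + ∑ i ∈ Finset.range m, l i) * (x m ^ 2 + y m ^ 2)
        + ∑ i ∈ Finset.range m, (x i * y (i + 1) - y i * x (i + 1)) / 2
        ≤ c * ∑ i ∈ Finset.range m, l i := by
      intro m
      induction m with
      | zero => intro _; simp [hx0, hy0]
      | succ m ih =>
        intro hm
        have h1 := ih (by omega)
        have h2 := hmono (m + 1) hm
        have h0 : 0 ≤ ∑ i ∈ Finset.range m, l i := Finset.sum_nonneg fun i _ => hl i
        rw [Finset.sum_range_succ] at h2
        have h3 := riccati_step (c := c) (θ := ε + ∑ i ∈ Finset.range m, l i) (l := l m)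
          (x := x m) (y := y m) hc0 (by linarith) (hl m) (by linarith) (h m (by omega))
        rw [Finset.sum_range_succ, Finset.sum_range_succ, mul_add]
        rw [add_sub_cancel, add_sub_cancel, add_assoc ε] at h3
        linarith
    have := ind n le_rfl
    simpa [hxn, hyn] using this
  refine le_of_forall_pos_le_add fun δ hδ => ?_
  have h1 := main (δ * (4 * Real.pi) / (2 * (L + 1))) (by positivity)
  refine h1.trans ?_
  have h2 : (L + 2 * (δ * (4 * Real.pi) / (2 * (L + 1)))) / (4 * Real.pi) * L
      = L ^ 2 / (4 * Real.pi) + δ * (L / (L + 1)) := by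
    field_simp
  rw [h2]
  have : L / (L + 1) ≤ 1 := by rw [div_le_one (by positivity)]; linarith
  nlinarith

/-- Moving the first vertex to the origin changes each term by a difference, and these telescope to
zero because the polygon is closed. -/
theorem sum_omega_translate (n : ℕ) (v : ℕ → V0) (hv : v n = v 0) :
    ∑ i ∈ Finset.range n, omega (v i - v 0) (v (i + 1) - v 0)
      = ∑ i ∈ Finset.range n, omega (v i) (v (i + 1)) := by
  have h1 : ∀ i, omega (v i - v 0) (v (i + 1) - v 0)
      = omega (v i) (v (i + 1)) - (omega (v 0) (v (i + 1)) - omega (v 0) (v i)) := fun i => by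
    simp only [omega, Pi.sub_apply]; ring
  simp_rw [h1]
  rw [Finset.sum_sub_distrib, Finset.sum_range_sub fun i => omega (v 0) (v i), hv, sub_self,
    sub_zero]

/-- The isoperimetric inequality for closed polygons with respect to `‖·‖_A`. -/
theorem abs_sum_omega_le (A : GL (Fin 2) ℝ) (n : ℕ) (v : ℕ → V0) (l : ℕ → ℝ) (hv : v n = v 0)
    (hl : ∀ i, 0 ≤ l i) (h : ∀ i < n, normA A (v (i + 1) - v i) ≤ l i) :
    |∑ i ∈ Finset.range n, omega (v i) (v (i + 1)) / 2|
      ≤ absDet A * ((∑ i ∈ Finset.range n, l i) ^ 2 / (4 * Real.pi)) := by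
  have hsq : ∀ i < n, (toEuc A (v (i + 1) - v 0) 0 - toEuc A (v i - v 0) 0) ^ 2
      + (toEuc A (v (i + 1) - v 0) 1 - toEuc A (v i - v 0) 1) ^ 2 ≤ l i ^ 2 := by
    intro i hi
    have h1 := pow_le_pow_left₀ (normA_nonneg A _) (h i hi) 2
    rw [normA_sq] at h1
    simpa only [map_sub, PiLp.sub_apply, sub_sub_sub_cancel_right] using h1
  have h1 := polygon_isoperimetric n (fun i => toEuc A (v i - v 0) 0)
    (fun i => toEuc A (v i - v 0) 1) l (by simp) (by simp) (by simp [hv]) (by simp [hv]) hl hsq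
  -- Exchanging the two coordinates reverses the orientation, which bounds the signed area from
  -- below.
  have h2 := polygon_isoperimetric n (fun i => toEuc A (v i - v 0) 1)
    (fun i => toEuc A (v i - v 0) 0) l (by simp) (by simp) (by simp [hv]) (by simp [hv]) hl
    (fun i hi => by rw [add_comm]; exact hsq i hi)
  have e : ∑ i ∈ Finset.range n, omega (v i) (v (i + 1)) / 2
      = (A : Matrix (Fin 2) (Fin 2) ℝ).det * ∑ i ∈ Finset.range n,
        (toEuc A (v i - v 0) 0 * toEuc A (v (i + 1) - v 0) 1
          - toEuc A (v i - v 0) 1 * toEuc A (v (i + 1) - v 0) 0) / 2 := by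
    rw [← Finset.sum_div, ← sum_omega_translate n v hv, ← Finset.sum_div, ← mul_div_assoc,
      Finset.mul_sum]
    congr 1
    refine Finset.sum_congr rfl fun i _ => ?_
    rw [omega_eq_det_mul A]
    simp only [omega]
  rw [e, abs_mul]
  refine mul_le_mul_of_nonneg_left (abs_le.2 ⟨?_, h1⟩) (abs_nonneg _)
  rw [neg_le, ← Finset.sum_neg_distrib]
  refine le_trans (le_of_eq (Finset.sum_congr rfl fun i _ => ?_)) h2
  ring

/-- The vertical coordinate of `p⁻¹ q`. -/
def vert (p q : Heis) : ℝ := (p⁻¹ * q).2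

theorem vert_eq (p q : Heis) : vert p q = q.2 - p.2 - omega p.1 q.1 / 2 := by
  simp [vert, omega]; ring

theorem vert_mul_left (g p q : Heis) : vert (g * p) (g * q) = vert p q := by
  simp [vert, mul_assoc]

/-- A discrete horizontal-up-to-errors loop which gains height `z` has length at least
`2 √(π |z| / |det A|)`, up to the errors. -/
theorem abs_height_le (A : GL (Fin 2) ℝ) (n : ℕ) (p : ℕ → Heis) (l : ℕ → ℝ) (ε : ℝ)
    (hp : (p n).1 = (p 0).1) (hl : ∀ i, 0 ≤ l i)
    (h : ∀ i < n, normA A ((p (i + 1)).1 - (p i).1) ≤ l i)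
    (h' : ∀ i < n, |vert (p i) (p (i + 1))| ≤ ε * l i) :
    |(p n).2 - (p 0).2| ≤ absDet A * ((∑ i ∈ Finset.range n, l i) ^ 2 / (4 * Real.pi))
      + ε * ∑ i ∈ Finset.range n, l i := by
  -- The height gained is the signed area of the projected polygon plus the vertical defects of the
  -- steps.
  have e : (p n).2 - (p 0).2 = ∑ i ∈ Finset.range n, omega (p i).1 (p (i + 1)).1 / 2
      + ∑ i ∈ Finset.range n, vert (p i) (p (i + 1)) := by
    rw [← Finset.sum_add_distrib, ← Finset.sum_range_sub fun i => (p i).2]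
    refine Finset.sum_congr rfl fun i _ => ?_
    rw [vert_eq]; ring
  rw [e]
  refine (abs_add_le _ _).trans (add_le_add
    (abs_sum_omega_le A n (fun i => (p i).1) l hp hl h) ?_)
  rw [Finset.mul_sum]
  exact (Finset.abs_sum_le_sum_abs _ _).trans
    (Finset.sum_le_sum fun i hi => h' i (Finset.mem_range.1 hi))

/-! ## Absolutely continuous horizontal curves -/

theorem absolutelyContinuous_coord {v : ℝ → V0} {a b : ℝ}
    (hv : AbsolutelyContinuousOnInterval v a b) (i : Fin 2) :
    AbsolutelyContinuousOnInterval (fun t => v t i) a b := by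
  refine squeeze_zero (fun E => Finset.sum_nonneg fun _ _ => dist_nonneg)
    (fun E => Finset.sum_le_sum fun j _ => ?_) hv
  exact dist_le_pi_dist (v (E.2 j).1) (v (E.2 j).2) i

/-- At a point where v is not differentiable, `deriv v` takes the default value 0 although a
coordinate may have a nonzero derivative. Absolute continuity makes such points negligible. -/
theorem ae_hasDerivAt_of_absolutelyContinuous {v : ℝ → V0} {a b : ℝ}
    (hv : AbsolutelyContinuousOnInterval v a b) :
    ∀ᵐ t, t ∈ uIcc a b → ∀ i, deriv v t i = deriv (fun s => v s i) t := by
  filter_upwards [(absolutelyContinuous_coord hv 0).ae_differentiableAt,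
    (absolutelyContinuous_coord hv 1).ae_differentiableAt] with t h0 h1 ht i
  have h : ∀ i, DifferentiableAt ℝ (fun s => v s i) t := by
    intro i; fin_cases i
    · exact h0 ht
    · exact h1 ht
  rw [deriv_pi h]

theorem intervalIntegrable_deriv_of_absolutelyContinuous {v : ℝ → V0} {a b : ℝ}
    (hv : AbsolutelyContinuousOnInterval v a b) : IntervalIntegrable (deriv v) volume a b := by
  rw [intervalIntegrable_iff]
  refine Integrable.of_eval fun i => ?_
  have h := intervalIntegrable_iff.1 (absolutelyContinuous_coord hv i).intervalIntegrable_deriv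
  refine h.congr ?_
  rw [Filter.EventuallyEq, ae_restrict_iff' measurableSet_uIoc]
  filter_upwards [ae_hasDerivAt_of_absolutelyContinuous hv] with t ht hm
  exact (ht (uIoc_subset_uIcc hm) i).symm

theorem integral_deriv_of_absolutelyContinuous {v : ℝ → V0} {a b : ℝ}
    (hv : AbsolutelyContinuousOnInterval v a b) : ∫ t in a..b, deriv v t = v b - v a := by
  ext i
  have h1 := (ContinuousLinearMap.proj (R := ℝ) (φ := fun _ : Fin 2 => ℝ) i).intervalIntegral_comp_comm
    (intervalIntegrable_deriv_of_absolutelyContinuous hv)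
  simp only [ContinuousLinearMap.proj_apply] at h1
  rw [← h1, Pi.sub_apply, ← (absolutelyContinuous_coord hv i).integral_deriv_eq_sub]
  refine intervalIntegral.integral_congr_ae ?_
  filter_upwards [ae_hasDerivAt_of_absolutelyContinuous hv] with t ht hm
  exact ht (uIoc_subset_uIcc hm) i

/-- The length of the part of a horizontal curve between the times `s` and `t`. -/
def pathLen (A : GL (Fin 2) ℝ) (c : ℝ → Heis) (s t : ℝ) : ℝ :=
  ∫ τ in s..t, normA A (deriv (fun x => (c x).1) τ)

theorem intervalIntegrable_normA_deriv (A : GL (Fin 2) ℝ) {v : ℝ → V0} {a b : ℝ}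
    (hv : AbsolutelyContinuousOnInterval v a b) :
    IntervalIntegrable (fun t => normA A (deriv v t)) volume a b := by
  have h := intervalIntegrable_deriv_of_absolutelyContinuous hv
  have h2 : IntervalIntegrable (fun t => toEuc A (deriv v t)) volume a b :=
    ⟨(toEuc A).integrable_comp h.1, (toEuc A).integrable_comp h.2⟩
  exact h2.norm

theorem normA_sub_le_of_absolutelyContinuous (A : GL (Fin 2) ℝ) {v : ℝ → V0} {a b : ℝ}
    (hab : a ≤ b) (hv : AbsolutelyContinuousOnInterval v a b) :
    normA A (v b - v a) ≤ ∫ t in a..b, normA A (deriv v t) := by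
  rw [← integral_deriv_of_absolutelyContinuous hv, normA_eq, ←
    (toEuc A).intervalIntegral_comp_comm (intervalIntegrable_deriv_of_absolutelyContinuous hv)]
  exact intervalIntegral.norm_integral_le_integral_norm hab

theorem uIcc_subset_unit {s t : ℝ} (hs : 0 ≤ s) (hst : s ≤ t) (ht : t ≤ 1) :
    uIcc s t ⊆ uIcc (0 : ℝ) 1 := by
  rw [uIcc_of_le hst, uIcc_of_le zero_le_one]
  exact Icc_subset_Icc hs ht

theorem Admissible.normA_sub_le (A : GL (Fin 2) ℝ) {c : ℝ → Heis} (hc : Admissible c) {s t : ℝ}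
    (hs : 0 ≤ s) (hst : s ≤ t) (ht : t ≤ 1) :
    normA A ((c t).1 - (c s).1) ≤ pathLen A c s t := by
  have h := hc.1.mono (uIcc_subset_unit hs hst ht)
  exact normA_sub_le_of_absolutelyContinuous A (v := fun x => (c x).1) hst h

theorem Admissible.pathLen_mono (A : GL (Fin 2) ℝ) {c : ℝ → Heis} (hc : Admissible c) {s t u : ℝ}
    (hs : 0 ≤ s) (hst : s ≤ t) (htu : t ≤ u) (hu : u ≤ 1) : pathLen A c s t ≤ pathLen A c s u := by
  refine intervalIntegral.integral_mono_interval le_rfl hst htu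
    (Filter.Eventually.of_forall fun _ => normA_nonneg A _) ?_
  exact intervalIntegrable_normA_deriv A (hc.1.mono (uIcc_subset_unit hs (hst.trans htu) hu))

theorem pathLen_nonneg (A : GL (Fin 2) ℝ) (c : ℝ → Heis) {s t : ℝ} (hst : s ≤ t) :
    0 ≤ pathLen A c s t :=
  intervalIntegral.integral_nonneg hst fun _ _ => normA_nonneg A _

/-- Horizontality means z' = ω(v, v')/2; subtracting ω(v(s), v')/2 recentres the swept area at the
initial point. -/
theorem Admissible.vert_eq_integral {c : ℝ → Heis} (hc : Admissible c) {s t : ℝ}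
    (hs : 0 ≤ s) (hst : s ≤ t) (ht : t ≤ 1) :
    vert (c s) (c t)
      = ∫ τ in s..t, omega ((c τ).1 - (c s).1) (deriv (fun x => (c x).1) τ) / 2 := by
  have hsub := uIcc_subset_unit hs hst ht
  have h1 := hc.1.mono hsub
  have h2 := hc.2.1.mono hsub
  have e1 : omega (c s).1 (c t).1 / 2
      = ∫ τ in s..t, omega (c s).1 (deriv (fun x => (c x).1) τ) / 2 := by
    let T : V0 →ₗ[ℝ] ℝ :=
      { toFun := fun w => omega (c s).1 w / 2
        map_add' := fun u w => by rw [omega_add_right]; ring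
        map_smul' := fun m u => by rw [omega_smul_right]; simp; ring }
    have h3 := (LinearMap.toContinuousLinearMap T).intervalIntegral_comp_comm
      (intervalIntegrable_deriv_of_absolutelyContinuous h1)
    rw [integral_deriv_of_absolutelyContinuous h1] at h3
    refine Eq.trans ?_ h3.symm
    change _ = omega (c s).1 ((c t).1 - (c s).1) / 2
    rw [omega_sub_right, omega_self, sub_zero]
  have hi : IntervalIntegrable (fun τ => omega (c s).1 (deriv (fun x => (c x).1) τ) / 2)
      volume s t := by
    have h4 : ∀ i : Fin 2, IntervalIntegrable (fun τ => deriv (fun x => (c x).1) τ i) volume s t :=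
      fun i => by
        have h := intervalIntegrable_deriv_of_absolutelyContinuous h1
        exact ⟨(ContinuousLinearMap.proj (R := ℝ) (φ := fun _ : Fin 2 => ℝ) i).integrable_comp h.1,
          (ContinuousLinearMap.proj (R := ℝ) (φ := fun _ : Fin 2 => ℝ) i).integrable_comp h.2⟩
    exact (((h4 1).const_mul _).sub ((h4 0).const_mul _)).div_const 2
  rw [vert_eq, ← h2.integral_deriv_eq_sub, e1,
    ← intervalIntegral.integral_sub h2.intervalIntegrable_deriv hi]
  refine intervalIntegral.integral_congr_ae ?_
  have h3 := hc.2.2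
  rw [ae_restrict_iff' measurableSet_Icc] at h3
  filter_upwards [h3] with τ hτ hm
  obtain ⟨U, hU⟩ := hτ (by
    have := hsub (uIoc_subset_uIcc hm); rwa [uIcc_of_le zero_le_one] at this)
  simp only [leftTransport, Prod.mk.injEq] at hU
  rw [hU.1, hU.2, omega_sub_left]
  ring

/-- Each displacement from c(s) is at most the path length. The constant is not sharp; what matters
is the quadratic order, which makes vertical errors negligible on short steps. -/
theorem Admissible.abs_vert_le (A : GL (Fin 2) ℝ) {c : ℝ → Heis} (hc : Admissible c) {s t : ℝ}
    (hs : 0 ≤ s) (hst : s ≤ t) (ht : t ≤ 1) :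
    |vert (c s) (c t)| ≤ absDet A / 2 * pathLen A c s t ^ 2 := by
  have hD := absDet_pos A
  rw [hc.vert_eq_integral hs hst ht, ← Real.norm_eq_abs]
  have h1 := intervalIntegrable_normA_deriv A (hc.1.mono (uIcc_subset_unit hs hst ht))
  refine (intervalIntegral.norm_integral_le_of_norm_le hst (g := fun τ =>
    absDet A / 2 * pathLen A c s t * normA A (deriv (fun x => (c x).1) τ)) ?_
    (h1.const_mul _)).trans ?_
  · refine Filter.Eventually.of_forall fun τ hτ => ?_
    rw [Real.norm_eq_abs, abs_div, abs_two]
    have h2 := abs_omega_le A ((c τ).1 - (c s).1) (deriv (fun x => (c x).1) τ)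
    have h3 := (hc.normA_sub_le A hs hτ.1.le (hτ.2.trans ht)).trans
      (hc.pathLen_mono A hs hτ.1.le hτ.2 ht)
    have h4 := mul_le_mul_of_nonneg_right h3 (normA_nonneg A (deriv (fun x => (c x).1) τ))
    have h5 := mul_le_mul_of_nonneg_left h4 hD.le
    linarith
  · rw [intervalIntegral.integral_const_mul]
    exact le_of_eq (by simp only [pathLen]; ring)

theorem Admissible.srLength_eq (A : GL (Fin 2) ℝ) {c : ℝ → Heis} (hc : Admissible c) :
    srLength A c = ENNReal.ofReal (pathLen A c 0 1) := by
  have h := intervalIntegrable_normA_deriv A hc.1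
  rw [intervalIntegrable_iff_integrableOn_Icc_of_le zero_le_one] at h
  rw [srLength, pathLen, intervalIntegral.integral_of_le zero_le_one, ← integral_Icc_eq_integral_Ioc,
    ofReal_integral_eq_lintegral_ofReal h (Filter.Eventually.of_forall fun _ => normA_nonneg A _)]

/-! ## Lower bounds for the distance -/

theorem ofReal_normA_le_srDist (A : GL (Fin 2) ℝ) (p q : Heis) :
    ENNReal.ofReal (normA A (q.1 - p.1)) ≤ srDist A p q := by
  refine le_iInf fun c => le_iInf fun hc => le_iInf fun h0 => le_iInf fun h1 => ?_
  rw [hc.srLength_eq]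
  have := hc.normA_sub_le A le_rfl zero_le_one le_rfl
  rw [h0, h1] at this
  exact ENNReal.ofReal_le_ofReal this

theorem ofReal_sqrt_vert_le_srDist (A : GL (Fin 2) ℝ) (p q : Heis) :
    ENNReal.ofReal √(2 / absDet A * |vert p q|) ≤ srDist A p q := by
  refine le_iInf fun c => le_iInf fun hc => le_iInf fun h0 => le_iInf fun h1 => ?_
  rw [hc.srLength_eq]
  have := hc.abs_vert_le A le_rfl zero_le_one le_rfl
  rw [h0, h1] at this
  refine ENNReal.ofReal_le_ofReal (Real.sqrt_le_iff.2 ⟨pathLen_nonneg A c zero_le_one, ?_⟩)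
  have hD := absDet_pos A
  calc 2 / absDet A * |vert p q| ≤ 2 / absDet A * (absDet A / 2 * pathLen A c 0 1 ^ 2) := by gcongr
    _ = pathLen A c 0 1 ^ 2 := by field_simp

/-- The sub-Riemannian isoperimetric inequality. -/
theorem Admissible.abs_height_le (A : GL (Fin 2) ℝ) {c : ℝ → Heis} (hc : Admissible c)
    (h : (c 1).1 = (c 0).1) :
    |(c 1).2 - (c 0).2| ≤ absDet A * (pathLen A c 0 1 ^ 2 / (4 * Real.pi)) := by
  have hD := absDet_pos A
  set L := pathLen A c 0 1
  have hL : 0 ≤ L := pathLen_nonneg A c zero_le_one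
  have hint := intervalIntegrable_normA_deriv A hc.1
  have hcont : ContinuousOn (fun t => pathLen A c 0 t) (Icc 0 1) := by
    have := intervalIntegral.continuousOn_primitive_interval (a := 0) (b := 1)
      (f := fun τ => normA A (deriv (fun x => (c x).1) τ)) (μ := volume)
      (by rw [uIcc_of_le zero_le_one]
          exact (intervalIntegrable_iff_integrableOn_Icc_of_le zero_le_one).1 hint)
    rwa [uIcc_of_le zero_le_one] at this
  have huc := isCompact_Icc.uniformContinuousOn_of_continuous hcont
  have hsplit : ∀ s t, 0 ≤ s → s ≤ t → t ≤ 1 →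
      pathLen A c s t = pathLen A c 0 t - pathLen A c 0 s := by
    intro s t h0 h1 h2
    have := intervalIntegral.integral_add_adjacent_intervals
      (hint.mono_set (uIcc_subset_unit le_rfl h0 (h1.trans h2)))
      (hint.mono_set (uIcc_subset_unit h0 h1 h2))
    simp only [pathLen]
    linarith
  refine le_of_forall_pos_le_add fun δ hδ => ?_
  rw [Metric.uniformContinuousOn_iff] at huc
  -- Steps of length l ≤ δ / (D/2 · (L + 1)) have vertical defect at most D/2 · l² ≤ δ/(L + 1) · l,
  -- so the defects sum to at most δ.
  obtain ⟨η, hη, hηc⟩ := huc (δ / (absDet A / 2 * (L + 1))) (by positivity)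
  obtain ⟨n, hn⟩ := exists_nat_one_div_lt hη
  set N := n + 1
  have hN : (0 : ℝ) < N := by positivity
  have hmem : ∀ i : ℕ, i ≤ N → (0 : ℝ) ≤ i / N ∧ (i : ℝ) / N ≤ 1 := fun i hi =>
    ⟨by positivity, by rw [div_le_one hN]; exact_mod_cast hi⟩
  have hstep : ∀ i : ℕ, (i : ℝ) / N ≤ ((i + 1 : ℕ) : ℝ) / N := fun i => by
    gcongr; simp
  have key := SubRiem.abs_height_le A N (fun i => c (i / N))
    (fun i => pathLen A c (i / N) ((i + 1 : ℕ) / N)) (δ / (L + 1))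
    (by simp [hN.ne', h]) (fun i => pathLen_nonneg A c (hstep i))
    (fun i hi => hc.normA_sub_le A (hmem i hi.le).1 (hstep i) (hmem (i + 1) hi).2)
    (fun i hi => by
      have h1 := hc.abs_vert_le A (hmem i hi.le).1 (hstep i) (hmem (i + 1) hi).2
      have h2 : pathLen A c (i / N) ((i + 1 : ℕ) / N) ≤ δ / (absDet A / 2 * (L + 1)) := by
        have := hηc _ (hmem (i + 1) hi) _ (hmem i hi.le) (by
          rw [Real.dist_eq, abs_of_nonneg (sub_nonneg.2 (hstep i))]
          push_cast
          rw [add_div, add_sub_cancel_left]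
          simpa [N] using hn)
        rw [hsplit _ _ (hmem i hi.le).1 (hstep i) (hmem (i + 1) hi).2]
        exact (le_abs_self _).trans this.le
      have h3 := pathLen_nonneg A c (hstep i)
      refine h1.trans ?_
      rw [pow_two, ← mul_assoc]
      refine mul_le_mul_of_nonneg_right ?_ h3
      calc absDet A / 2 * pathLen A c (i / N) ((i + 1 : ℕ) / N)
          ≤ absDet A / 2 * (δ / (absDet A / 2 * (L + 1))) := by gcongr
        _ = δ / (L + 1) := by field_simp)
  have hsum : ∑ i ∈ Finset.range N, pathLen A c (i / N) ((i + 1 : ℕ) / N) = L := by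
    rw [Finset.sum_congr rfl fun i hi => hsplit _ _ (hmem i (Finset.mem_range.1 hi).le).1 (hstep i)
      (hmem (i + 1) (Finset.mem_range.1 hi)).2,
      Finset.sum_range_sub fun i : ℕ => pathLen A c 0 ((i : ℕ) / N)]
    simp [hN.ne', L, pathLen]
  simp only [hsum, div_self hN.ne', Nat.cast_zero, zero_div] at key
  refine key.trans ?_
  have : δ / (L + 1) * L ≤ δ := by
    rw [div_mul_eq_mul_div, div_le_iff₀ (by positivity)]; nlinarith
  linarith

theorem ofReal_le_srDist_vertical (A : GL (Fin 2) ℝ) (z : ℝ) :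
    ENNReal.ofReal (2 * √(Real.pi * |z| / absDet A)) ≤ srDist A 1 (hexp 0 z) := by
  refine le_iInf fun c => le_iInf fun hc => le_iInf fun h0 => le_iInf fun h1 => ?_
  have hD := absDet_pos A
  have hpi := Real.pi_pos
  rw [hc.srLength_eq]
  have := hc.abs_height_le A (by rw [h0, h1]; simp)
  rw [h0, h1, snd_hexp, Heis.snd_one, sub_zero] at this
  refine ENNReal.ofReal_le_ofReal ?_
  have hL := pathLen_nonneg A c zero_le_one
  have h2 : √(Real.pi * |z| / absDet A) ≤ pathLen A c 0 1 / 2 := by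
    refine Real.sqrt_le_iff.2 ⟨by positivity, ?_⟩
    rw [div_le_iff₀ hD]
    calc Real.pi * |z| ≤ Real.pi * (absDet A * (pathLen A c 0 1 ^ 2 / (4 * Real.pi))) := by gcongr
      _ = _ := by field_simp; norm_num
  linarith

/-! ## Smooth horizontal curves of constant speed -/

/-- Horizontal `C¹` curves of constant speed `K`. -/
structure HasSpeed (A : GL (Fin 2) ℝ) (K : ℝ) (c : ℝ → Heis) : Prop where
  contDiff_fst : ContDiff ℝ 1 fun t => (c t).1
  contDiff_snd : ContDiff ℝ 1 fun t => (c t).2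
  deriv_snd : ∀ t, deriv (fun s => (c s).2) t = omega (c t).1 (deriv (fun s => (c s).1) t) / 2
  normA_deriv : ∀ t, normA A (deriv (fun s => (c s).1) t) = K

theorem srDist_le_srLength (A : GL (Fin 2) ℝ) {c : ℝ → Heis} (hc : Admissible c) :
    srDist A (c 0) (c 1) ≤ srLength A c :=
  (iInf_le _ c).trans ((iInf_le _ hc).trans ((iInf_le _ rfl).trans (iInf_le _ rfl)))

theorem HasSpeed.srDist_le {A : GL (Fin 2) ℝ} {K : ℝ} {c : ℝ → Heis} (hc : HasSpeed A K c)
    (s t : ℝ) : srDist A (c s) (c t) ≤ ENNReal.ofReal (|t - s| * K) := by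
  -- Admissible curves live on [0,1], so the piece between s and t is reparametrised affinely; t < s
  -- is allowed.
  set φ : ℝ → ℝ := fun τ => s + τ * (t - s) with hφ
  have hφ1 : ContDiff ℝ 1 φ := by fun_prop
  have hφ' : ∀ τ, HasDerivAt φ (t - s) τ := fun τ => by
    exact (((hasDerivAt_id τ).mul_const (t - s)).const_add s).congr_deriv (one_mul _)
  have d1 : ∀ τ, deriv (fun x => (c (φ x)).1) τ
      = (t - s) • deriv (fun x => (c x).1) (φ τ) := fun τ =>
    (((hc.contDiff_fst.differentiable one_ne_zero (φ τ)).hasDerivAt).scomp τ (hφ' τ)).deriv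
  have d2 : ∀ τ, deriv (fun x => (c (φ x)).2) τ
      = (t - s) * deriv (fun x => (c x).2) (φ τ) := fun τ =>
    (((hc.contDiff_snd.differentiable one_ne_zero (φ τ)).hasDerivAt).scomp τ (hφ' τ)).deriv
  have hadm : Admissible fun τ => c (φ τ) := by
    refine ⟨(hc.contDiff_fst.comp hφ1).contDiffOn.absolutelyContinuousOnInterval,
      (hc.contDiff_snd.comp hφ1).contDiffOn.absolutelyContinuousOnInterval,
      Filter.Eventually.of_forall fun τ => ⟨_, Prod.ext rfl ?_⟩⟩
    simp only [leftTransport]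
    rw [d1, d2, hc.deriv_snd, omega_smul_right]
    ring
  have h := srDist_le_srLength A hadm
  simp only [hφ, zero_mul, add_zero, one_mul, add_sub_cancel] at h
  refine h.trans ?_
  change srLength A (fun τ => c (φ τ)) ≤ _
  rw [hadm.srLength_eq]
  refine ENNReal.ofReal_le_ofReal (le_of_eq ?_)
  simp only [pathLen, d1, normA_smul, hc.normA_deriv]
  simp

theorem hasSpeed_line (A : GL (Fin 2) ℝ) (p : Heis) (u : V0) :
    HasSpeed A (normA A u) fun t => p * hexp (t • u) 0 := by
  have h1 : ∀ t, HasDerivAt (fun t : ℝ => (p * hexp (t • u) 0).1) u t := fun t => by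
    simpa using! ((hasDerivAt_id t).smul_const u).const_add p.1
  have h2 : ∀ t, HasDerivAt (fun t : ℝ => (p * hexp (t • u) 0).2) (omega p.1 u / 2) t := fun t => by
    have : (fun t : ℝ => (p * hexp (t • u) 0).2) = fun t : ℝ => p.2 + t * (omega p.1 u / 2) := by
      funext t
      simp [omega_smul_right]; ring
    rw [this]
    simpa using! ((hasDerivAt_id t).mul_const (omega p.1 u / 2)).const_add p.2
  refine ⟨?_, ?_, fun t => ?_, fun t => ?_⟩
  · simp only [Heis.fst_mul, fst_hexp]; fun_prop
  · simp only [Heis.snd_mul, fst_hexp, snd_hexp, omega_smul_right]; fun_prop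
  · rw [(h1 t).deriv, (h2 t).deriv]
    simp [omega]; ring
  · rw [(h1 t).deriv]

/-- The lift to the Heisenberg group of a circle of radius `ρ` through the origin. -/
def circleLift (A : GL (Fin 2) ℝ) (ρ t : ℝ) : Heis :=
  hexp ((A : Matrix (Fin 2) (Fin 2) ℝ) *ᵥ
      ![ρ * Real.sin (2 * Real.pi * t), ρ * (1 - Real.cos (2 * Real.pi * t))])
    ((A : Matrix (Fin 2) (Fin 2) ℝ).det * (ρ ^ 2 * (Real.pi * t - Real.sin (2 * Real.pi * t) / 2)))

theorem hasSpeed_circleLift (A : GL (Fin 2) ℝ) {ρ : ℝ} (hρ : 0 ≤ ρ) :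
    HasSpeed A (2 * Real.pi * ρ) (circleLift A ρ) := by
  have hpi := Real.pi_pos
  have hθ : ∀ t, HasDerivAt (fun t : ℝ => 2 * Real.pi * t) (2 * Real.pi) t := fun t => by
    simpa using (hasDerivAt_id t).const_mul (2 * Real.pi)
  have hw : ∀ t, HasDerivAt (fun t : ℝ => ![ρ * Real.sin (2 * Real.pi * t),
      ρ * (1 - Real.cos (2 * Real.pi * t))]) ((2 * Real.pi * ρ) • ![Real.cos (2 * Real.pi * t),
        Real.sin (2 * Real.pi * t)]) t := fun t => by
    rw [hasDerivAt_pi]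
    intro i
    fin_cases i
    · simpa [mul_comm, mul_assoc, mul_left_comm] using! (hθ t).sin.const_mul ρ
    · simpa [mul_comm, mul_assoc, mul_left_comm] using! ((hθ t).cos.const_sub 1).const_mul ρ
  have h1 : ∀ t, HasDerivAt (fun t => (circleLift A ρ t).1) ((A : Matrix (Fin 2) (Fin 2) ℝ) *ᵥ
      ((2 * Real.pi * ρ) • ![Real.cos (2 * Real.pi * t), Real.sin (2 * Real.pi * t)])) t :=
    fun t => ((Matrix.mulVecLin (A : Matrix (Fin 2) (Fin 2) ℝ)).toContinuousLinearMap.hasFDerivAt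
      |>.comp_hasDerivAt t (hw t))
  have h2 : ∀ t, HasDerivAt (fun t => (circleLift A ρ t).2)
      ((A : Matrix (Fin 2) (Fin 2) ℝ).det * (ρ ^ 2 * (Real.pi
        - Real.cos (2 * Real.pi * t) * (2 * Real.pi) / 2))) t := fun t => by
    simpa using! ((((hasDerivAt_id t).const_mul Real.pi).sub ((hθ t).sin.div_const 2)).const_mul
      (ρ ^ 2)).const_mul _
  refine ⟨?_, ?_, fun t => ?_, fun t => ?_⟩
  · refine (Matrix.mulVecLin (A : Matrix (Fin 2) (Fin 2) ℝ)).toContinuousLinearMap.contDiff.comp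
      (contDiff_pi.2 fun i => ?_)
    fin_cases i
    · simp; fun_prop
    · simp; fun_prop
  · simp only [circleLift, snd_hexp]; fun_prop
  · rw [(h1 t).deriv, (h2 t).deriv, circleLift, fst_hexp, omega_mulVec, omega_smul_right]
    simp only [omega, Matrix.cons_val_zero, Matrix.cons_val_one]
    linear_combination (-((A : Matrix (Fin 2) (Fin 2) ℝ).det * ρ ^ 2 * Real.pi))
      * Real.sin_sq_add_cos_sq (2 * Real.pi * t)
  · rw [(h1 t).deriv, normA_eq, toEuc_mulVec, EuclideanSpace.norm_eq]
    simp [Fin.sum_univ_two, mul_pow, ← mul_add]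
    rw [← mul_pow, ← mul_pow, Real.sqrt_sq (by positivity)]

/-- A closed geodesic of minimal length in the circle fibre. -/
theorem exists_vertical_loop (A : GL (Fin 2) ℝ) : ∃ (c : ℝ → Heis) (p : ℤ),
    HasSpeed A (2 * √(Real.pi / absDet A)) c ∧ (p = 1 ∨ p = -1) ∧ c 0 = 1 ∧ c 1 = hexp 0 p := by
  have hD := absDet_pos A
  have hpi := Real.pi_pos
  -- The radius makes the lifted circle rise by exactly π ρ² |det A| = 1.
  have h := hasSpeed_circleLift A (ρ := √(1 / (Real.pi * absDet A))) (by positivity)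
  have e : 2 * Real.pi * √(1 / (Real.pi * absDet A)) = 2 * √(Real.pi / absDet A) := by
    rw [mul_assoc]
    congr 1
    rw [← Real.sqrt_sq hpi.le, ← Real.sqrt_mul (by positivity), Real.sqrt_sq hpi.le]
    congr 1
    field_simp
  rw [e] at h
  have hz : (A : Matrix (Fin 2) (Fin 2) ℝ).det * (1 / (Real.pi * absDet A) * Real.pi)
      = (A : Matrix (Fin 2) (Fin 2) ℝ).det / absDet A := by field_simp
  have h0 : circleLift A √(1 / (Real.pi * absDet A)) 0 = 1 :=
    Heis.ext' (by ext i; fin_cases i <;> simp [circleLift]) (by simp [circleLift])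
  have h1 : circleLift A √(1 / (Real.pi * absDet A)) 1
      = hexp 0 ((A : Matrix (Fin 2) (Fin 2) ℝ).det / absDet A) := by
    refine Heis.ext' (by ext i; fin_cases i <;> simp [circleLift]) ?_
    rw [← hz]
    simp only [circleLift, snd_hexp, mul_one, Real.sin_two_pi, zero_div, sub_zero]
    rw [Real.sq_sqrt (by positivity)]
  -- The sign of det A decides whether the lift goes up or down.
  rcases lt_or_gt_of_ne (det_ne_zero A) with hd | hd
  · refine ⟨_, -1, h, Or.inr rfl, h0, ?_⟩
    rw [h1, absDet, abs_of_neg hd, div_neg, div_self hd.ne]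
    simp
  · refine ⟨_, 1, h, Or.inl rfl, h0, ?_⟩
    rw [h1, absDet, abs_of_pos hd, div_self hd.ne']
    simp

theorem s2_eq (A : GL (Fin 2) ℝ) : s2 A = ENNReal.ofReal (2 * √(Real.pi / absDet A)) := by
  have hD := absDet_pos A
  have hpi := Real.pi_pos
  refine le_antisymm ?_ ?_
  · obtain ⟨c, p, hc, hp, h0, h1⟩ := exists_vertical_loop A
    refine iInf_le_of_le p <| iInf_le_of_le (by omega) ?_
    have := hc.srDist_le 0 1
    rw [h0, h1] at this
    simpa using this
  · refine le_iInf fun p => le_iInf fun hp => le_trans ?_ (ofReal_le_srDist_vertical A p)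
    have h1 : (1 : ℝ) ≤ |(p : ℝ)| := by exact_mod_cast Int.one_le_abs hp
    refine ENNReal.ofReal_le_ofReal ?_
    gcongr
    nlinarith

/-! ## Homology classes of loops and covering maps -/

section Homology

variable {X : Type*} [TopologicalSpace X]

theorem loopClass_eq_zero_iff {c : C(unitInterval, X)} (hc : c 0 = c 1) :
    loopClass c hc = 0 ↔ Finsupp.single c 1 ∈ LinearMap.range (boundary2 (X := X)) := by
  rw [loopClass, Submodule.Quotient.mk_eq_zero]
  rfl

theorem boundary2_single (σ : C(stdSimplex ℝ (Fin 3), X)) :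
    boundary2 (Finsupp.single σ 1) = Finsupp.single (σ.comp (edge 1 2)) 1
      - Finsupp.single (σ.comp (edge 0 2)) 1 + Finsupp.single (σ.comp (edge 0 1)) (1 : ℤ) := by
  simp [boundary2]

/-- The cone over a curve in a normed space, with apex the initial point. -/
theorem continuous_cone {F : Type*} [NormedAddCommGroup F] [NormedSpace ℝ F]
    (Γ : C(unitInterval, F)) : Continuous fun x : stdSimplex ℝ (Fin 3) =>
      Γ 0 + (x.1 1 + x.1 2) • (Γ (projIcc 0 1 zero_le_one (x.1 2 / (x.1 1 + x.1 2))) - Γ 0) := by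
  obtain ⟨M, hM⟩ : ∃ M, ∀ t, ‖Γ t - Γ 0‖ ≤ M := by
    obtain ⟨M, hM⟩ := (isCompact_range (f := fun t => ‖Γ t - Γ 0‖) (by fun_prop)).bddAbove
    exact ⟨M, fun t => hM ⟨t, rfl⟩⟩
  have c1 : Continuous fun x : stdSimplex ℝ (Fin 3) => x.1 1 + x.1 2 :=
    ((continuous_apply 1).comp continuous_subtype_val).add
      ((continuous_apply 2).comp continuous_subtype_val)
  have c2 : Continuous fun x : stdSimplex ℝ (Fin 3) => x.1 2 :=
    (continuous_apply 2).comp continuous_subtype_val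
  refine continuous_iff_continuousAt.2 fun x => ?_
  by_cases hx : x.1 1 + x.1 2 = 0
  -- At the apex the quotient is 0/0 and has no limit, but Γ is bounded and the factor x₁ + x₂ tends
  -- to 0.
  · have h0 : Filter.Tendsto (fun x : stdSimplex ℝ (Fin 3) => (x.1 1 + x.1 2) •
        (Γ (projIcc 0 1 zero_le_one (x.1 2 / (x.1 1 + x.1 2))) - Γ 0)) (nhds x) (nhds 0) := by
      refine squeeze_zero_norm (a := fun x : stdSimplex ℝ (Fin 3) => |x.1 1 + x.1 2| * M)
        (fun y => ?_) ?_
      · rw [norm_smul, Real.norm_eq_abs]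
        exact mul_le_mul_of_nonneg_left (hM _) (abs_nonneg _)
      · have := (c1.abs.mul_const M).tendsto x
        simpa [hx] using this
    have h1 := h0.const_add (Γ 0)
    rw [ContinuousAt]
    simpa [hx] using h1
  · have h1 : ContinuousAt (fun x : stdSimplex ℝ (Fin 3) => x.1 2 / (x.1 1 + x.1 2)) x :=
      c2.continuousAt.div c1.continuousAt hx
    have h2 : ContinuousAt (fun x : stdSimplex ℝ (Fin 3) =>
        Γ (projIcc 0 1 zero_le_one (x.1 2 / (x.1 1 + x.1 2)))) x :=
      (Γ.continuous.comp continuous_projIcc).continuousAt.comp h1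
    exact continuousAt_const.add (c1.continuousAt.smul (h2.sub continuousAt_const))

/-- A loop which lifts to a loop in a normed space is null-homologous. -/
theorem loopClass_eq_zero_of_lift {F : Type*} [NormedAddCommGroup F] [NormedSpace ℝ F] {p : F → X}
    (hp : Continuous p) (Γ : C(unitInterval, F)) (hΓ : Γ 0 = Γ 1) {c : C(unitInterval, X)}
    (hc : c 0 = c 1) (h : ∀ t, p (Γ t) = c t) : loopClass c hc = 0 := by
  rw [loopClass_eq_zero_iff]
  refine ⟨Finsupp.single ⟨_, hp.comp (continuous_cone Γ)⟩ 1, ?_⟩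
  rw [boundary2_single]
  -- The edge opposite the apex traces the curve. The other two edges are constant, as Γ ends where
  -- it starts, and cancel in the boundary.
  have e1 : ContinuousMap.comp ⟨_, hp.comp (continuous_cone Γ)⟩ (edge 1 2) = c := by
    ext t
    simp [edge, ← h t]
  have e2 : ContinuousMap.comp ⟨_, hp.comp (continuous_cone Γ)⟩ (edge 0 2)
      = ContinuousMap.comp ⟨_, hp.comp (continuous_cone Γ)⟩ (edge 0 1) := by
    ext t
    by_cases ht : (t : ℝ) = 0
    · simp [edge, ht]
    · simp [edge, ht, projIcc, ← hΓ]
  rw [e1, e2, sub_add_cancel]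

variable {E G M : Type*} [TopologicalSpace E] [Group G] [MulAction G E] [AddCommGroup M]
  {p : E → X}

theorem exists_lift (hp : IsQuotientCoveringMap p G) (c : C(unitInterval, X)) :
    ∃ Γ : C(unitInterval, E), ∀ t, p (Γ t) = c t := by
  obtain ⟨e, he⟩ := hp.surjective (c 0)
  obtain ⟨Γ, hΓ, -⟩ := hp.isCoveringMap.exists_path_lifts c e he.symm
  exact ⟨Γ, congrFun hΓ⟩

/-- The variation along a curve, after lifting, of a function `h` on the covering space. -/
def liftVariation (hp : IsQuotientCoveringMap p G) (h : E → M) (c : C(unitInterval, X)) : M :=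
  h ((exists_lift hp c).choose 1) - h ((exists_lift hp c).choose 0)

/-- Two lifts of one curve differ by a deck transformation, which changes h by an additive constant;
hence the variation does not depend on the lift. No continuity of h is needed. -/
theorem liftVariation_eq (hp : IsQuotientCoveringMap p G) {h : E → M}
    (hh : ∀ g : G, ∃ m : M, ∀ e, h (g • e) = m + h e) {c : C(unitInterval, X)}
    {Γ : C(unitInterval, E)} (hΓ : ∀ t, p (Γ t) = c t) :
    liftVariation hp h c = h (Γ 1) - h (Γ 0) := by
  have hΔ := (exists_lift hp c).choose_spec
  rw [liftVariation]
  generalize (exists_lift hp c).choose = Δ at hΔ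
  obtain ⟨g, hg⟩ := hp.apply_eq_iff_mem_orbit.1 ((hΓ 0).trans (hΔ 0).symm)
  have hcont : Continuous fun t => g • Δ t := by
    have := hp.toContinuousConstSMul
    fun_prop
  have heq : (fun t => g • Δ t) = Γ := by
    refine hp.isCoveringMap.eq_of_comp_eq hcont Γ.continuous (funext fun t => ?_) 0 hg
    simp [hp.map_smul, hΓ, hΔ]
  obtain ⟨m, hm⟩ := hh g
  rw [← congrFun heq 1, ← congrFun heq 0]
  simp only [hm]
  abel

/-- A singular triangle lifts because the standard triangle is simply connected, and the variations
of h along the three lifted edges cancel. So `liftVariation` is a cocycle and can detect homology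
classes. -/
theorem liftVariation_boundary2 (hp : IsQuotientCoveringMap p G) {h : E → M}
    (hh : ∀ g : G, ∃ m : M, ∀ e, h (g • e) = m + h e) (x : Chain2 X) :
    Finsupp.linearCombination ℤ (liftVariation hp h) (boundary2 x) = 0 := by
  suffices H : Finsupp.linearCombination ℤ (liftVariation hp h) ∘ₗ boundary2 = 0 from
    LinearMap.congr_fun H x
  ext σ
  have : ContractibleSpace (stdSimplex ℝ (Fin 3)) :=
    (convex_stdSimplex ℝ (Fin 3)).contractibleSpace ⟨_, single_mem_stdSimplex ℝ (0 : Fin 3)⟩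
  have : LocallyPathConnectedSpace (stdSimplex ℝ (Fin 3)) :=
    (convex_stdSimplex ℝ (Fin 3)).locallyPathConnectedSpace
  obtain ⟨e, he⟩ := hp.surjective (σ (edge 0 1 0))
  obtain ⟨S, ⟨-, hS⟩, -⟩ := hp.isCoveringMap.existsUnique_continuousMap_lifts σ _ e he
  have key : ∀ i j, liftVariation hp h (σ.comp (edge i j))
      = h (S (edge i j 1)) - h (S (edge i j 0)) := fun i j =>
    liftVariation_eq hp hh (Γ := S.comp (edge i j)) fun t => congrFun hS _
  have h01 : edge 1 2 0 = edge 0 1 1 := by ext k; simp [edge]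
  have h02 : edge 0 2 0 = edge 0 1 0 := by ext k; simp [edge]
  have h12 : edge 1 2 1 = edge 0 2 1 := by ext k; simp [edge]
  simp only [LinearMap.coe_comp, Function.comp_apply, Finsupp.lsingle_apply, boundary2_single,
    map_add, map_sub, Finsupp.linearCombination_single, one_smul, key, h01, h02, h12,
    LinearMap.zero_apply]
  abel

theorem loopClass_ne_zero (hp : IsQuotientCoveringMap p G) {h : E → M}
    (hh : ∀ g : G, ∃ m : M, ∀ e, h (g • e) = m + h e) {c : C(unitInterval, X)} (hc : c 0 = c 1)
    {Γ : C(unitInterval, E)} (hΓ : ∀ t, p (Γ t) = c t) (hne : h (Γ 0) ≠ h (Γ 1)) :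
    loopClass c hc ≠ 0 := by
  rw [Ne, loopClass_eq_zero_iff]
  rintro ⟨x, hx⟩
  have h1 := liftVariation_boundary2 hp hh x
  rw [hx, Finsupp.linearCombination_single, one_smul, liftVariation_eq hp hh hΓ] at h1
  exact hne (sub_eq_zero.1 h1).symm

end Homology

/-! ## The covering `H₁ → Γ_r \ H₁` -/

instance : IsTopologicalGroup Heis where
  continuous_mul := by
    have h1 : Continuous fun p : Heis × Heis => p.1.1 :=
      (continuous_fst (X := V0) (Y := ℝ)).comp continuous_fst
    have h2 : Continuous fun p : Heis × Heis => p.2.1 :=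
      (continuous_fst (X := V0) (Y := ℝ)).comp continuous_snd
    have h3 : Continuous fun p : Heis × Heis => p.1.2 :=
      (continuous_snd (X := V0) (Y := ℝ)).comp continuous_fst
    have h4 : Continuous fun p : Heis × Heis => p.2.2 :=
      (continuous_snd (X := V0) (Y := ℝ)).comp continuous_snd
    exact (h1.add h2).prodMk ((h3.add h4).add ((continuous_omega.comp (h1.prodMk h2)).div_const 2))
  continuous_inv := ((continuous_fst (X := V0) (Y := ℝ)).neg).prodMk
    ((continuous_snd (X := V0) (Y := ℝ)).neg)

theorem Heis.continuous_fst : Continuous fun p : Heis => p.1 :=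
  _root_.continuous_fst (X := V0) (Y := ℝ)

theorem Heis.continuous_snd : Continuous fun p : Heis => p.2 :=
  _root_.continuous_snd (X := V0) (Y := ℝ)

theorem eq_zero_of_abs_lt_half {n : ℤ} (h : |(n : ℝ)| < 1 / 2) : n = 0 := by
  have h1 : |(n : ℝ)| < 1 := h.trans (by norm_num)
  rw [← Int.cast_abs] at h1
  have : |n| < 1 := by exact_mod_cast h1
  exact Int.abs_lt_one_iff.1 this

theorem isDiscrete_Gam {r : ℕ} (hr : 0 < r) : IsDiscrete (Gam r : Set Heis) := by
  rw [isDiscrete_iff_forall_mem_exists_isOpen]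
  intro g hg
  have hco := (continuous_const_mul (g⁻¹ : Heis))
  have hc1 := Heis.continuous_fst.comp hco
  have hc2 := Heis.continuous_snd.comp hco
  refine ⟨{q | |(g⁻¹ * q).1 0| < 1 / 2} ∩ {q | |(g⁻¹ * q).1 1| < 1 / 2}
    ∩ {q | |(g⁻¹ * q).2| < 1 / 2}, ?_, ?_⟩
  · exact ((isOpen_lt ((continuous_apply 0).comp hc1).abs continuous_const).inter
      (isOpen_lt ((continuous_apply 1).comp hc1).abs continuous_const)).inter
      (isOpen_lt hc2.abs continuous_const)
  · ext q
    constructor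
    · rintro ⟨⟨⟨h0, h1⟩, h2⟩, hq⟩
      obtain ⟨a, b, c, habc⟩ := mem_Gam.1 (mul_mem (inv_mem hg) hq)
      simp only [mem_ofPred_eq, habc, fst_latticePt, snd_latticePt, Matrix.cons_val_zero,
        Matrix.cons_val_one] at h0 h1 h2
      -- The horizontal coordinates ra and b are integers and vanish first; only then is the
      -- vertical coordinate c + rab/2 known to be an integer.
      have hb := eq_zero_of_abs_lt_half h1
      have ha : a = 0 := by
        have := eq_zero_of_abs_lt_half (n := r * a) (by push_cast; exact h0)
        simpa [hr.ne'] using this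
      subst ha hb
      have hc : c = 0 := eq_zero_of_abs_lt_half (by simpa using h2)
      subst hc
      rw [latticePt_zero, inv_mul_eq_one] at habc
      exact habc.symm
    · rintro rfl
      simp only [mem_inter_iff, mem_ofPred_eq, inv_mul_cancel]
      simpa using hg

theorem isQuotientCoveringMap_mk {r : ℕ} (hr : 0 < r) :
    IsQuotientCoveringMap (Quotient.mk _ : Heis → HeisMfd r) (Gam r) :=
  isQuotientMap_quotient_mk'.isQuotientCoveringMap_of_subgroup (Gam r) (isDiscrete_Gam hr)
    (Quotient.eq''.trans QuotientGroup.rightRel_apply)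

theorem mk_eq_mk_iff {r : ℕ} (hr : 0 < r) {p q : Heis} :
    (Quotient.mk _ p : HeisMfd r) = Quotient.mk _ q ↔ ∃ g ∈ Gam r, p = g * q := by
  rw [(isQuotientCoveringMap_mk hr).apply_eq_iff_mem_orbit]
  constructor
  · rintro ⟨g, hg⟩
    exact ⟨g, g.2, hg.symm⟩
  · rintro ⟨g, hg, rfl⟩
    exact ⟨⟨g, hg⟩, rfl⟩

/-- A function with values in `ℝ / rℤ` detecting the centre of `Γ_r` modulo its commutators. -/
def centralHeight (r : ℕ) (p : Heis) : AddCircle (r : ℝ) :=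
  ((p.2 - p.1 0 * p.1 1 / 2 + ⌊p.1 1⌋ * p.1 0 : ℝ) : AddCircle (r : ℝ))

/-- Writing p = exp(xX) exp(yY) exp(wZ), left multiplication by `latticePt r a b c` turns w into w +
c - bx. The term ⌊y⌋x grows by bx plus a multiple of r, so modulo r only c remains. -/
theorem centralHeight_latticePt_mul (r : ℕ) (a b c : ℤ) (p : Heis) :
    centralHeight r (latticePt r a b c * p) = (c : ℝ) + centralHeight r p := by
  have h : (latticePt r a b c * p).2 - (latticePt r a b c * p).1 0 * (latticePt r a b c * p).1 1 / 2
      + ⌊(latticePt r a b c * p).1 1⌋ * (latticePt r a b c * p).1 0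
      = (c + (p.2 - p.1 0 * p.1 1 / 2 + ⌊p.1 1⌋ * p.1 0)) + (a * (b + ⌊p.1 1⌋) : ℤ) • (r : ℝ) := by
    simp only [Heis.fst_mul, Heis.snd_mul, fst_latticePt, snd_latticePt, omega, Pi.add_apply,
      Matrix.cons_val_zero, Matrix.cons_val_one, Int.floor_intCast_add, zsmul_eq_mul]
    push_cast
    ring
  rw [centralHeight, h, AddCircle.coe_add, AddCircle.coe_zsmul, AddCircle.coe_period, smul_zero,
    add_zero, AddCircle.coe_add, centralHeight]

/-! ## Upper bounds for the systole -/

theorem quotDist_mk_le (r : ℕ) (A : GL (Fin 2) ℝ) (p q : Heis) :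
    quotDist r A (Quotient.mk _ p) (Quotient.mk _ q) ≤ srDist A p q :=
  (iInf_le _ p).trans ((iInf_le _ rfl).trans ((iInf_le _ q).trans (iInf_le _ rfl)))

theorem HasSpeed.continuous {A : GL (Fin 2) ℝ} {K : ℝ} {c : ℝ → Heis} (hc : HasSpeed A K c) :
    Continuous c :=
  hc.contDiff_fst.continuous.prodMk hc.contDiff_snd.continuous

theorem HasSpeed.curveLength_le (r : ℕ) {A : GL (Fin 2) ℝ} {K : ℝ} {c : ℝ → Heis}
    (hc : HasSpeed A K c) : curveLength (quotDist r A)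
      (fun t : unitInterval => (Quotient.mk _ (c t) : HeisMfd r)) ≤ ENNReal.ofReal K := by
  have hK : 0 ≤ K := hc.normA_deriv 0 ▸ normA_nonneg A _
  refine iSup_le fun ⟨n, u, hu⟩ => ?_
  have hu' : ∀ i, (0 : ℝ) ≤ (u (i + 1) : ℝ) - u i := fun i => sub_nonneg.2 (hu (Nat.le_succ i))
  calc ∑ i ∈ Finset.range n, quotDist r A (Quotient.mk _ (c (u (i + 1)))) (Quotient.mk _ (c (u i)))
      ≤ ∑ i ∈ Finset.range n, ENNReal.ofReal (((u (i + 1) : ℝ) - u i) * K) := by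
        refine Finset.sum_le_sum fun i _ => (quotDist_mk_le r A _ _).trans ?_
        refine (hc.srDist_le _ _).trans_eq ?_
        rw [abs_sub_comm, abs_of_nonneg (hu' i)]
    _ = ENNReal.ofReal (((u n : ℝ) - u 0) * K) := by
        rw [← ENNReal.ofReal_sum_of_nonneg fun i _ => mul_nonneg (hu' i) hK, ← Finset.sum_mul,
          Finset.sum_range_sub fun i => (u i : ℝ)]
    _ ≤ ENNReal.ofReal K := by
        refine ENNReal.ofReal_le_ofReal (mul_le_of_le_one_left hK ?_)
        have h1 := (u n).2.2
        have h2 := (u 0).2.1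
        linarith

/-- An additively equivariant function taking different values at the two ends certifies that the
projected loop is not null-homologous. -/
theorem heisSystole_le {r : ℕ} (hr : 0 < r) {A : GL (Fin 2) ℝ} {K : ℝ} {c : ℝ → Heis}
    (hc : HasSpeed A K c) {g : Heis} (hg : g ∈ Gam r) (h1 : c 1 = g * c 0)
    {M : Type*} [AddCommGroup M] (h : Heis → M)
    (hh : ∀ g : Gam r, ∃ m : M, ∀ e, h (g • e) = m + h e) (hne : h (c 0) ≠ h (c 1)) :
    heisSystole r A ≤ ENNReal.ofReal K := by
  have hp := isQuotientCoveringMap_mk hr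
  let Γ : C(unitInterval, Heis) := ⟨fun t => c t, hc.continuous.comp continuous_subtype_val⟩
  let γ : C(unitInterval, HeisMfd r) :=
    ⟨fun t => Quotient.mk _ (c t), hp.isCoveringMap.continuous.comp Γ.continuous⟩
  have hγ : γ 0 = γ 1 := by
    symm
    change (Quotient.mk _ (c ((1 : unitInterval) : ℝ)) : HeisMfd r)
      = Quotient.mk _ (c ((0 : unitInterval) : ℝ))
    rw [mk_eq_mk_iff hr]
    exact ⟨g, hg, by simpa using h1⟩
  have hcl : loopClass γ hγ ≠ 0 :=
    loopClass_ne_zero hp hh hγ (Γ := Γ) (fun t => rfl) (by simpa [Γ] using hne)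
  exact (iInf_le _ γ).trans ((iInf_le _ hγ).trans ((iInf_le _ hcl).trans (hc.curveLength_le r)))

theorem heisSystole_le_s1 {r : ℕ} (hr : 0 < r) (A : GL (Fin 2) ℝ) : heisSystole r A ≤ s1 r A := by
  refine le_iInf fun u => le_iInf fun hu => le_iInf fun hu0 => ?_
  obtain ⟨g, hg, rfl⟩ := hu
  have hn : g.1 0 ^ 2 + g.1 1 ^ 2 ≠ 0 := fun h => hu0 <| by
    ext i
    fin_cases i
    · exact pow_eq_zero_iff two_ne_zero |>.1 (by simp; nlinarith [sq_nonneg (g.1 0), sq_nonneg (g.1 1)])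
    · exact pow_eq_zero_iff two_ne_zero |>.1 (by simp; nlinarith [sq_nonneg (g.1 0), sq_nonneg (g.1 1)])
  -- The base point solves ω(x, g.1) = g.2, that is, x⁻¹ g x = exp(g.1): conjugation removes the
  -- vertical part. The line x exp(t g.1) then ends at g x and closes up in the quotient.
  set x := hexp ((g.2 / (g.1 0 ^ 2 + g.1 1 ^ 2)) • ![g.1 1, -g.1 0]) 0
  refine heisSystole_le hr (hasSpeed_line A x g.1) hg ?_ (M := V0) (fun p => p.1)
    (fun γ => ⟨γ.1.1, fun e => rfl⟩) ?_
  · have h0 : x * hexp ((0 : ℝ) • g.1) 0 = x := Heis.ext' (by simp) (by simp [omega])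
    simp only [h0]
    refine Heis.ext' (by simp [add_comm]) ?_
    simp only [x, omega, Heis.snd_mul, fst_hexp, snd_hexp, one_smul, Pi.smul_apply, smul_eq_mul,
      Matrix.cons_val_zero, Matrix.cons_val_one]
    field_simp
    ring
  · simpa using hu0

theorem heisSystole_le_s2 {r : ℕ} (hr : 2 ≤ r) (A : GL (Fin 2) ℝ) : heisSystole r A ≤ s2 A := by
  obtain ⟨c, p, hc, hp, h0, h1⟩ := exists_vertical_loop A
  have hp' : hexp 0 (p : ℝ) = latticePt r 0 0 p :=
    Heis.ext' (by ext i; fin_cases i <;> simp) (by simp)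
  rw [s2_eq]
  refine heisSystole_le (by omega) hc (g := latticePt r 0 0 p) (mem_Gam.2 ⟨_, _, _, rfl⟩)
    (by rw [h0, h1, hp', mul_one]) (centralHeight r) (fun g => ?_) ?_
  · obtain ⟨a, b, k, hg⟩ := mem_Gam.1 g.2
    refine ⟨(k : ℝ), fun e => ?_⟩
    change centralHeight r (g.1 * e) = _
    rw [hg, centralHeight_latticePt_mul]
  · rw [h0, h1, hp', ← mul_one (latticePt r 0 0 p), centralHeight_latticePt_mul]
    -- Equality of the heights would mean that r divides p = ±1; this is where r ≥ 2 is used.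
    intro h
    rw [right_eq_add, AddCircle.coe_eq_zero_iff] at h
    obtain ⟨n, hn⟩ := h
    have hn' : n * (r : ℤ) = p := by
      rw [zsmul_eq_mul] at hn; exact_mod_cast hn
    have hdvd : (r : ℤ) ∣ 1 := by
      rcases hp with rfl | rfl
      · exact ⟨n, by linarith⟩
      · exact ⟨-n, by linarith⟩
    have := Int.le_of_dvd one_pos hdvd
    omega

/-! ## Lower bounds for the systole -/

theorem exists_le_normA_of_mem_baseLattice {r : ℕ} (hr : 0 < r) (A : GL (Fin 2) ℝ) :
    ∃ m > 0, ∀ u ∈ baseLattice r, u ≠ 0 → m ≤ normA A u := by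
  obtain ⟨κ, hκ, h⟩ := exists_mul_abs_le_normA A
  refine ⟨κ, hκ, fun u hu hu0 => ?_⟩
  obtain ⟨a, b, rfl⟩ := mem_baseLattice.1 hu
  have hr1 : (1 : ℝ) ≤ r := by exact_mod_cast hr
  by_cases ha : a = 0
  · have hb : b ≠ 0 := fun hb => hu0 (by ext i; fin_cases i <;> simp [ha, hb])
    have h1 : (1 : ℝ) ≤ |(b : ℝ)| := by exact_mod_cast Int.one_le_abs hb
    refine le_trans ?_ (h _ 1)
    simpa using mul_le_mul_of_nonneg_left h1 hκ.le
  · have h1 : (1 : ℝ) ≤ |(a : ℝ)| := by exact_mod_cast Int.one_le_abs ha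
    refine le_trans ?_ (h _ 0)
    have h2 : (1 : ℝ) ≤ |(r : ℝ) * a| := by
      rw [abs_mul, Nat.abs_cast]; nlinarith
    simpa using mul_le_mul_of_nonneg_left h2 hκ.le

/-- The quotient distance is locally bounded below by the same quantities as the distance. -/
theorem exists_le_quotDist {r : ℕ} (hr : 0 < r) (A : GL (Fin 2) ℝ) : ∃ δ > 0, ∀ p q : Heis,
    normA A (q.1 - p.1) ≤ δ → |vert p q| ≤ δ →
    ENNReal.ofReal (normA A (q.1 - p.1)) ≤ quotDist r A (Quotient.mk _ p) (Quotient.mk _ q) ∧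
    ENNReal.ofReal √(2 / absDet A * |vert p q|)
      ≤ quotDist r A (Quotient.mk _ p) (Quotient.mk _ q) := by
  obtain ⟨m, hm, hmin⟩ := exists_le_normA_of_mem_baseLattice hr A
  have hD := absDet_pos A
  -- The bound 1/2 keeps |k + vert| ≥ |vert| for central translates with k ≠ 0. For the other
  -- translates the displacement is at least m - m/2, and Dm²/8 is the value with 2/D · Dm²/8 =
  -- (m/2)².
  refine ⟨min (1 / 2) (min (m / 2) (absDet A * m ^ 2 / 8)), by positivity, fun p q hpq hv => ?_⟩
  rw [le_min_iff, le_min_iff] at hpq hv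
  suffices H : ∀ p' q' : Heis, (Quotient.mk _ p' : HeisMfd r) = Quotient.mk _ p →
      (Quotient.mk _ q' : HeisMfd r) = Quotient.mk _ q →
      ENNReal.ofReal (normA A (q.1 - p.1)) ≤ srDist A p' q' ∧
      ENNReal.ofReal √(2 / absDet A * |vert p q|) ≤ srDist A p' q' from
    ⟨le_iInf fun p' => le_iInf fun hp => le_iInf fun q' => le_iInf fun hq => (H p' q' hp hq).1,
      le_iInf fun p' => le_iInf fun hp => le_iInf fun q' => le_iInf fun hq => (H p' q' hp hq).2⟩
  intro p' q' hp hq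
  obtain ⟨g₁, hg₁, rfl⟩ := (mk_eq_mk_iff hr).1 hp
  obtain ⟨g₂, hg₂, rfl⟩ := (mk_eq_mk_iff hr).1 hq
  obtain ⟨g, hg, rfl⟩ : ∃ g ∈ Gam r, g₂ = g₁ * g :=
    ⟨g₁⁻¹ * g₂, mul_mem (inv_mem hg₁) hg₂, by group⟩
  have b1 := ofReal_normA_le_srDist A (g₁ * p) (g₁ * g * q)
  have b2 := ofReal_sqrt_vert_le_srDist A (g₁ * p) (g₁ * g * q)
  rw [mul_assoc, vert_mul_left] at b2
  have e1 : (g₁ * g * q).1 - (g₁ * p).1 = g.1 + (q.1 - p.1) := by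
    simp only [Heis.fst_mul]; abel
  rw [e1] at b1
  by_cases h0 : g.1 = 0
  · obtain ⟨k, rfl⟩ := exists_eq_hexp_of_fst_eq_zero hr hg h0
    rw [fst_hexp, zero_add] at b1
    refine ⟨b1, le_trans (ENNReal.ofReal_le_ofReal (Real.sqrt_le_sqrt ?_)) (mul_assoc g₁ _ q ▸ b2)⟩
    have e2 : vert p (hexp 0 k * q) = k + vert p q := by
      simp [vert_eq, omega]; ring
    rw [e2]
    refine mul_le_mul_of_nonneg_left ?_ (by positivity)
    by_cases hk : k = 0
    · simp [hk]
    · have h1 : (1 : ℝ) ≤ |(k : ℝ)| := by exact_mod_cast Int.one_le_abs hk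
      have h2 := abs_sub_abs_le_abs_add (k : ℝ) (vert p q)
      linarith [hv.1]
  · have h1 : m / 2 ≤ normA A (g.1 + (q.1 - p.1)) := by
      have h2 := hmin _ (fst_mem_baseLattice hg) h0
      have h3 := normA_add_le A (g.1 + (q.1 - p.1)) (-(q.1 - p.1))
      rw [add_neg_cancel_right, normA_neg] at h3
      linarith [hpq.2.1]
    have h2 := (ENNReal.ofReal_le_ofReal h1).trans b1
    refine ⟨(ENNReal.ofReal_le_ofReal hpq.2.1).trans h2,
      (ENNReal.ofReal_le_ofReal (Real.sqrt_le_iff.2 ⟨by positivity, ?_⟩)).trans h2⟩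
    calc 2 / absDet A * |vert p q| ≤ 2 / absDet A * (absDet A * m ^ 2 / 8) := by
          have := hv.2.2
          gcongr
      _ = (m / 2) ^ 2 := by field_simp; ring

theorem vert_self (p : Heis) : vert p p = 0 := by simp [vert]

theorem vert_comm (p q : Heis) : vert q p = -vert p q := by
  simp only [vert_eq, omega]; ring

theorem exists_close (A : GL (Fin 2) ℝ) (Γ : C(unitInterval, Heis)) {ε : ℝ} (hε : 0 < ε) :
    ∃ η > 0, ∀ s t, dist s t < η → normA A ((Γ t).1 - (Γ s).1) ≤ ε ∧ |vert (Γ s) (Γ t)| ≤ ε := by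
  have h1 : Continuous fun x : unitInterval × unitInterval =>
      normA A ((Γ x.2).1 - (Γ x.1).1) + |vert (Γ x.1) (Γ x.2)| := by
    have c1 := Heis.continuous_fst.comp (Γ.continuous.comp
      (continuous_fst (X := unitInterval) (Y := unitInterval)))
    have c2 := Heis.continuous_fst.comp (Γ.continuous.comp
      (continuous_snd (X := unitInterval) (Y := unitInterval)))
    refine ((continuous_normA A).comp (c2.sub c1)).add (Continuous.abs ?_)
    exact Heis.continuous_snd.comp ((Γ.continuous.comp continuous_fst).inv.mul
      (Γ.continuous.comp continuous_snd))
  have h2 := CompactSpace.uniformContinuous_of_continuous h1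
  obtain ⟨η, hη, h⟩ := Metric.uniformContinuous_iff.1 h2 ε hε
  refine ⟨η, hη, fun s t hst => ?_⟩
  have h3 := h (a := (s, t)) (b := (s, s)) (by simpa [Prod.dist_eq, hη, dist_comm] using hst)
  simp only [sub_self, normA_zero, vert_self, abs_zero, add_zero, Real.dist_eq, sub_zero] at h3
  have h4 := (le_abs_self _).trans h3.le
  have h5 := normA_nonneg A ((Γ t).1 - (Γ s).1)
  have h6 := abs_nonneg (vert (Γ s) (Γ t))
  exact ⟨by linarith, by linarith⟩

/-- The points of a subdivision of a lifted curve of finite length. -/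
theorem exists_subdivision {r : ℕ} (hr : 0 < r) (A : GL (Fin 2) ℝ) (Γ : C(unitInterval, Heis))
    (hL : curveLength (quotDist r A) (fun t => (Quotient.mk _ (Γ t) : HeisMfd r)) ≠ ⊤)
    {ε : ℝ} (hε : 0 < ε) : ∃ (n : ℕ) (p : ℕ → Heis) (l : ℕ → ℝ), p 0 = Γ 0 ∧ p n = Γ 1 ∧
      (∀ i, 0 ≤ l i) ∧ (∀ i < n, normA A ((p (i + 1)).1 - (p i).1) ≤ l i) ∧
      (∀ i < n, |vert (p i) (p (i + 1))| ≤ ε * l i) ∧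
      ∑ i ∈ Finset.range n, l i
        ≤ (curveLength (quotDist r A) (fun t => (Quotient.mk _ (Γ t) : HeisMfd r))).toReal := by
  have hD := absDet_pos A
  obtain ⟨δ, hδ, hloc⟩ := exists_le_quotDist hr A
  -- If w = |vert| satisfies w ≤ ε² · 2/D and √(2w/D) ≤ d, then w² ≤ ε² · (2w/D) ≤ (εd)²; this is
  -- the source of the second threshold.
  obtain ⟨η, hη, hclose⟩ := exists_close A Γ (ε := min δ (ε ^ 2 * (2 / absDet A))) (by positivity)
  obtain ⟨n, hn⟩ := exists_nat_one_div_lt hη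
  set N := n + 1
  have hN : (0 : ℝ) < N := by positivity
  set u : ℕ → unitInterval := fun i => projIcc 0 1 zero_le_one ((i : ℝ) / N) with hu
  have humono : Monotone u := fun i j hij => monotone_projIcc _ (by gcongr)
  have hu' : ∀ i ≤ N, (u i : ℝ) = i / N := fun i hi => by
    rw [hu]
    simp only
    rw [projIcc_of_mem zero_le_one ⟨by positivity, by rw [div_le_one hN]; exact_mod_cast hi⟩]
  -- The order of the arguments is that of `curveLength`. The estimates are reversed afterwards, so
  -- symmetry of `quotDist` is never needed.
  set d : ℕ → ℝ≥0∞ := fun i => quotDist r A (Quotient.mk _ (Γ (u (i + 1)))) (Quotient.mk _ (Γ (u i)))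
  have hsum : ∑ i ∈ Finset.range N, d i
      ≤ curveLength (quotDist r A) (fun t => (Quotient.mk _ (Γ t) : HeisMfd r)) :=
    le_iSup (fun p : ℕ × {u : ℕ → unitInterval // Monotone u} => ∑ i ∈ Finset.range p.1,
      quotDist r A (Quotient.mk _ (Γ (p.2.1 (i + 1)))) (Quotient.mk _ (Γ (p.2.1 i)))) (N, ⟨u, humono⟩)
  have hfin : ∀ i < N, d i ≠ ⊤ := fun i hi =>
    ne_top_of_le_ne_top hL ((Finset.single_le_sum (fun _ _ => zero_le)
      (Finset.mem_range.2 hi)).trans hsum)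
  have hcl : ∀ i < N, normA A ((Γ (u i)).1 - (Γ (u (i + 1))).1) ≤ min δ (ε ^ 2 * (2 / absDet A)) ∧
      |vert (Γ (u (i + 1))) (Γ (u i))| ≤ min δ (ε ^ 2 * (2 / absDet A)) := fun i hi => by
    refine hclose _ _ ?_
    rw [Subtype.dist_eq, hu' i hi.le, hu' (i + 1) hi, Real.dist_eq]
    push_cast
    rw [add_div, add_sub_cancel_left, abs_of_nonneg (by positivity)]
    simpa [N] using hn
  have hb : ∀ i < N, normA A ((Γ (u i)).1 - (Γ (u (i + 1))).1) ≤ (d i).toReal ∧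
      √(2 / absDet A * |vert (Γ (u (i + 1))) (Γ (u i))|) ≤ (d i).toReal := fun i hi => by
    obtain ⟨h1, h2⟩ := hcl i hi
    obtain ⟨h3, h4⟩ := hloc _ _ (h1.trans (min_le_left _ _)) (h2.trans (min_le_left _ _))
    exact ⟨(ENNReal.ofReal_le_iff_le_toReal (hfin i hi)).1 h3,
      (ENNReal.ofReal_le_iff_le_toReal (hfin i hi)).1 h4⟩
  refine ⟨N, fun i => Γ (u i), fun i => (d i).toReal, ?_, ?_, fun i => ENNReal.toReal_nonneg,
    fun i hi => ?_, fun i hi => ?_, ?_⟩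
  · simp [hu]
  · simp [hu, hN.ne']
  · rw [normA_sub_comm]; exact (hb i hi).1
  · rw [vert_comm, abs_neg]
    have h1 := (hcl i hi).2.trans (min_le_right _ _)
    have h2 := (hb i hi).2
    set w := |vert (Γ (u (i + 1))) (Γ (u i))|
    have hw : 0 ≤ w := abs_nonneg _
    have h3 : 2 / absDet A * w ≤ (d i).toReal ^ 2 := (Real.sqrt_le_left ENNReal.toReal_nonneg).1 h2
    refine abs_le_of_sq_le_sq' ?_ (by positivity) |>.2
    calc w ^ 2 = w * w := pow_two w
      _ ≤ ε ^ 2 * (2 / absDet A) * w := by gcongr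
      _ = ε ^ 2 * (2 / absDet A * w) := by ring
      _ ≤ ε ^ 2 * (d i).toReal ^ 2 := by gcongr
      _ = (ε * (d i).toReal) ^ 2 := by ring
  · rw [← ENNReal.toReal_sum fun i hi => hfin i (Finset.mem_range.1 hi)]
    exact ENNReal.toReal_mono hL hsum

/-- The deck transformation joining the ends of a lift decides the case: a nonzero horizontal part
gives s₁, a central element gives s₂ by the isoperimetric inequality. -/
theorem min_le_heisSystole {r : ℕ} (hr : 0 < r) (A : GL (Fin 2) ℝ) :
    min (s1 r A) (s2 A) ≤ heisSystole r A := by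
  refine le_iInf fun c => le_iInf fun hc => le_iInf fun hne => ?_
  have hD := absDet_pos A
  have hpi := Real.pi_pos
  obtain ⟨Γ, hΓ⟩ := exists_lift (isQuotientCoveringMap_mk hr) c
  rw [← show (fun t => Quotient.mk _ (Γ t)) = ⇑c from funext hΓ]
  by_cases hL : curveLength (quotDist r A) (fun t => (Quotient.mk _ (Γ t) : HeisMfd r)) = ⊤
  · rw [hL]; exact le_top
  obtain ⟨g, hg, hgΓ⟩ := (mk_eq_mk_iff hr).1 ((hΓ 1).trans (hc.symm.trans (hΓ 0).symm))
  have hsub := fun ε : ℝ => exists_subdivision hr A Γ hL (ε := ε)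
  rw [← ENNReal.ofReal_toReal hL]
  set L := (curveLength (quotDist r A) (fun t => (Quotient.mk _ (Γ t) : HeisMfd r))).toReal
  have hL0 : 0 ≤ L := ENNReal.toReal_nonneg
  by_cases h0 : g.1 = 0
  · refine (min_le_right _ _).trans ?_
    obtain ⟨k, rfl⟩ := exists_eq_hexp_of_fst_eq_zero hr hg h0
    -- For k = 0 the lift is a closed curve in V0 × ℝ, so the loop bounds a cone. This is the only
    -- use of the nontrivial homology class.
    have hk : k ≠ 0 := by
      rintro rfl
      have h1 : hexp 0 ((0 : ℤ) : ℝ) = 1 := Heis.ext' rfl (by simp)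
      rw [h1, one_mul] at hgΓ
      let Γ' : C(unitInterval, V0 × ℝ) := ⟨Γ, Γ.continuous⟩
      exact hne (loopClass_eq_zero_of_lift (F := V0 × ℝ)
        (isQuotientCoveringMap_mk hr).isCoveringMap.continuous Γ' hgΓ.symm hc hΓ)
    have h1 : (1 : ℝ) ≤ |(k : ℝ)| := by exact_mod_cast Int.one_le_abs hk
    have h2 : |(k : ℝ)| ≤ absDet A * (L ^ 2 / (4 * Real.pi)) := by
      refine le_of_forall_pos_le_add fun δ hδ => ?_
      obtain ⟨n, p, l, hp0, hpn, hl, hv, hh, hs⟩ := hsub (δ / (L + 1)) (by positivity)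
      have h3 := abs_height_le A n p l (δ / (L + 1)) (by rw [hp0, hpn, hgΓ]; simp) hl hv hh
      have h4 : (p n).2 - (p 0).2 = k := by
        rw [hp0, hpn, hgΓ]; simp [omega]
      rw [h4] at h3
      have h5 : 0 ≤ ∑ i ∈ Finset.range n, l i := Finset.sum_nonneg fun i _ => hl i
      refine h3.trans (add_le_add (by gcongr) ?_)
      calc δ / (L + 1) * ∑ i ∈ Finset.range n, l i ≤ δ / (L + 1) * L := by gcongr
        _ ≤ δ := by rw [div_mul_eq_mul_div, div_le_iff₀ (by positivity)]; nlinarith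
    rw [s2_eq]
    refine ENNReal.ofReal_le_ofReal ?_
    have h3 : √(Real.pi / absDet A) ≤ L / 2 := by
      refine Real.sqrt_le_iff.2 ⟨by positivity, ?_⟩
      rw [div_le_iff₀ hD]
      calc Real.pi = Real.pi * 1 := (mul_one _).symm
        _ ≤ Real.pi * (absDet A * (L ^ 2 / (4 * Real.pi))) := by gcongr; exact h1.trans h2
        _ = _ := by field_simp; norm_num
    linarith
  · refine (min_le_left _ _).trans ?_
    refine (iInf_le _ g.1).trans ((iInf_le _ (fst_mem_baseLattice hg)).trans ((iInf_le _ h0).trans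
      (ENNReal.ofReal_le_ofReal ?_)))
    obtain ⟨n, p, l, hp0, hpn, hl, hv, -, hs⟩ := hsub 1 one_pos
    refine le_trans ?_ hs
    have e : g.1 = ∑ i ∈ Finset.range n, ((p (i + 1)).1 - (p i).1) := by
      rw [Finset.sum_range_sub fun i => (p i).1, hp0, hpn, hgΓ]; simp
    rw [e, normA_eq, map_sum]
    exact (norm_sum_le _ _).trans (Finset.sum_le_sum fun i hi => hv i (Finset.mem_range.1 hi))

/-! ## Volumes -/

/-- In exponential coordinates a left translation is a translation of the base followed by
translations of the vertical fibres. -/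
theorem measurePreserving_mul_left (g : Heis) :
    MeasurePreserving (fun p : Heis => g * p) volume volume := by
  have h1 : MeasurePreserving (fun u : V0 => g.1 + u) volume volume :=
    measurePreserving_add_left volume g.1
  have hm : Measurable fun p : V0 × ℝ => g.2 + p.2 + omega g.1 p.1 / 2 := by
    have : Continuous fun p : V0 × ℝ => g.2 + p.2 + omega g.1 p.1 / 2 :=
      (continuous_const.add continuous_snd).add
        ((continuous_omega.comp (continuous_const.prodMk continuous_fst)).div_const 2)
    exact this.measurable
  refine h1.skew_product (μc := (volume : Measure ℝ)) (μd := (volume : Measure ℝ))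
    (g := fun u z => g.2 + z + omega g.1 u / 2) hm (Filter.Eventually.of_forall fun u => ?_)
  have e : (fun z : ℝ => g.2 + z + omega g.1 u / 2) = fun z => (g.2 + omega g.1 u / 2) + z := by
    funext z; ring
  rw [e]
  exact (measurePreserving_add_left volume _).map_eq

instance (r : ℕ) : MeasurableConstSMul (Gam r) Heis :=
  ⟨fun g => (measurePreserving_mul_left g.1).measurable⟩

instance (r : ℕ) : SMulInvariantMeasure (Gam r) Heis volume :=
  ⟨fun g _ hs => (measurePreserving_mul_left g.1).measure_preimage hs.nullMeasurableSet⟩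

instance (r : ℕ) (A : GL (Fin 2) ℝ) : SMulInvariantMeasure (Gam r) Heis (popp A) := by
  unfold popp; infer_instance

instance (r : ℕ) : Countable (Gam r) := by
  refine Function.Surjective.countable (α := ℤ × ℤ × ℤ)
    (f := fun x => ⟨latticePt r x.1 x.2.1 x.2.2, mem_Gam.2 ⟨_, _, _, rfl⟩⟩) fun ⟨g, hg⟩ => ?_
  obtain ⟨a, b, c, rfl⟩ := mem_Gam.1 hg
  exact ⟨(a, b, c), rfl⟩

instance (r : ℕ) : Countable (baseLattice r) := by
  refine Function.Surjective.countable (α := ℤ × ℤ)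
    (f := fun x => ⟨_, mem_baseLattice.2 ⟨x.1, x.2, rfl⟩⟩) fun ⟨u, hu⟩ => ?_
  obtain ⟨a, b, rfl⟩ := mem_baseLattice.1 hu
  exact ⟨(a, b), rfl⟩

/-- A fundamental parallelogram of the base lattice. -/
def baseBox (r : ℕ) : Set V0 := Set.pi univ fun i => Ico 0 (![(r : ℝ), 1] i)

theorem mem_baseBox {r : ℕ} {u : V0} :
    u ∈ baseBox r ↔ u 0 ∈ Ico (0 : ℝ) r ∧ u 1 ∈ Ico (0 : ℝ) 1 := by
  simp [baseBox, Fin.forall_fin_two]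

theorem measurableSet_baseBox (r : ℕ) : MeasurableSet (baseBox r) :=
  MeasurableSet.univ_pi fun _ => measurableSet_Ico

theorem volume_baseBox (r : ℕ) : volume (baseBox r) = ENNReal.ofReal r := by
  have := Real.volume_pi_Ico (a := (0 : Fin 2 → ℝ)) (b := ![(r : ℝ), 1])
  simpa [Fin.prod_univ_two, baseBox] using this

theorem existsUnique_latticePt_mem_baseBox {r : ℕ} (hr : 0 < r) (u : V0) :
    ∃ a b : ℤ, ∀ a' b' : ℤ, ![(r : ℝ) * a', (b' : ℝ)] + u ∈ baseBox r ↔ a' = a ∧ b' = b := by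
  obtain ⟨a, ha, ha'⟩ := existsUnique_add_zsmul_mem_Ico (a := (r : ℝ)) (by exact_mod_cast hr) (u 0) 0
  obtain ⟨b, hb, hb'⟩ := existsUnique_add_zsmul_mem_Ico (a := (1 : ℝ)) one_pos (u 1) 0
  refine ⟨a, b, fun a' b' => ?_⟩
  simp only [zsmul_eq_mul, zero_add, mul_one] at ha hb ha' hb'
  rw [mem_baseBox]
  simp only [Pi.add_apply, Matrix.cons_val_zero, Matrix.cons_val_one]
  constructor
  · rintro ⟨h1, h2⟩
    exact ⟨ha' a' (by rwa [add_comm, mul_comm]), hb' b' (by rwa [add_comm])⟩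
  · rintro ⟨rfl, rfl⟩
    exact ⟨by rwa [add_comm, mul_comm], by rwa [add_comm]⟩

theorem isAddFundamentalDomain_baseBox {r : ℕ} (hr : 0 < r) (μ : Measure V0) :
    IsAddFundamentalDomain (baseLattice r) (baseBox r) μ := by
  refine IsAddFundamentalDomain.mk' (measurableSet_baseBox r).nullMeasurableSet fun u => ?_
  obtain ⟨a, b, hab⟩ := existsUnique_latticePt_mem_baseBox hr u
  refine ⟨⟨_, mem_baseLattice.2 ⟨a, b, rfl⟩⟩, (hab a b).2 ⟨rfl, rfl⟩, ?_⟩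
  rintro ⟨w, hw⟩ hwu
  obtain ⟨a', b', rfl⟩ := mem_baseLattice.1 hw
  obtain ⟨rfl, rfl⟩ := (hab a' b').1 hwu
  rfl

theorem isFundamentalDomain_box {r : ℕ} (hr : 0 < r) (μ : Measure Heis) :
    IsFundamentalDomain (Gam r) (show Set Heis from baseBox r ×ˢ Ico (0 : ℝ) 1) μ := by
  have hm : MeasurableSet (show Set Heis from baseBox r ×ˢ Ico (0 : ℝ) 1) :=
    (measurableSet_baseBox r).prod measurableSet_Ico
  refine IsFundamentalDomain.mk' hm.nullMeasurableSet fun p => ?_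
  obtain ⟨a, b, hab⟩ := existsUnique_latticePt_mem_baseBox hr p.1
  -- The pair (a, b) is fixed by the base, and c then acts as an integer translation of the
  -- remaining vertical coordinate.
  obtain ⟨c, hc, hc'⟩ := existsUnique_add_zsmul_mem_Ico (a := (1 : ℝ)) one_pos
    (latticePt r a b 0 * p).2 0
  have hz : ∀ k : ℤ, (latticePt r a b k * p).2 = (latticePt r a b 0 * p).2 + k • (1 : ℝ) :=
    fun k => by simp; ring
  rw [zero_add] at hc hc'
  refine ⟨⟨_, mem_Gam.2 ⟨a, b, c, rfl⟩⟩, ⟨(hab a b).2 ⟨rfl, rfl⟩, ?_⟩, ?_⟩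
  · exact (hz c).symm ▸ hc
  · rintro ⟨g, hg⟩ ⟨h1, h2⟩
    obtain ⟨a', b', c', rfl⟩ := mem_Gam.1 hg
    obtain ⟨rfl, rfl⟩ := (hab a' b').1 h1
    obtain rfl : c' = c := hc' c' (by
      have h3 : (latticePt r a' b' c' * p).2 ∈ Ico (0 : ℝ) 1 := h2
      rw [hz] at h3
      exact h3)
    rfl

/-- The density is D⁻², one factor D⁻¹ coming from `norm2_one`, and the fundamental box has Lebesgue
volume r. -/
theorem poppVol_eq {r : ℕ} (hr : 0 < r) (A : GL (Fin 2) ℝ) :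
    poppVol r A = ENNReal.ofReal (r / absDet A ^ 2) := by
  have hD := absDet_pos A
  rw [poppVol, (isFundamentalDomain_box hr (popp A)).covolume_eq_volume, popp, Measure.smul_apply]
  have h : (volume : Measure Heis) (show Set Heis from baseBox r ×ˢ Ico (0 : ℝ) 1)
      = ENNReal.ofReal r := by
    change (volume : Measure (V0 × ℝ)) (baseBox r ×ˢ Ico (0 : ℝ) 1) = _
    rw [Measure.volume_eq_prod, Measure.prod_prod, volume_baseBox, Real.volume_Ico]
    simp
  rw [h, norm2_one, smul_eq_mul, ← ENNReal.ofReal_mul (by rw [← absDet]; positivity), ← absDet]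
  congr 1
  field_simp

theorem torusArea_eq {r : ℕ} (hr : 0 < r) (A : GL (Fin 2) ℝ) :
    torusArea r A = ENNReal.ofReal (r / absDet A) := by
  have hD := absDet_pos A
  rw [torusArea, (isAddFundamentalDomain_baseBox hr _).covolume_eq_volume, Measure.smul_apply,
    volume_baseBox, smul_eq_mul, ← absDet, ← ENNReal.ofReal_mul (by positivity)]
  congr 1
  field_simp

/-! ## Reduced bases of the base lattice -/

theorem exists_shortest {r : ℕ} (hr : 0 < r) (A : GL (Fin 2) ℝ) :
    ∃ u ∈ baseLattice r, u ≠ 0 ∧ ∀ w ∈ baseLattice r, w ≠ 0 → normA A u ≤ normA A w := by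
  obtain ⟨κ, hκ, hle⟩ := exists_mul_abs_le_normA A
  have he : ![(r : ℝ), 0] ∈ baseLattice r := mem_baseLattice.2 ⟨1, 0, by simp⟩
  have he0 : ![(r : ℝ), 0] ≠ 0 := fun h => by simpa [hr.ne'] using congrFun h 0
  set R := normA A ![(r : ℝ), 0]
  set S := {w | w ∈ baseLattice r ∧ w ≠ 0 ∧ normA A w ≤ R} with hS
  have hfin : S.Finite := by
    set B := ⌈R / κ⌉
    refine ((Finset.Icc (-B) B ×ˢ Finset.Icc (-B) B).finite_toSet.image
      fun x : ℤ × ℤ => ![(r : ℝ) * x.1, (x.2 : ℝ)]).subset ?_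
    rintro w ⟨hw, -, hwR⟩
    obtain ⟨a, b, rfl⟩ := mem_baseLattice.1 hw
    have hB : R / κ ≤ B := Int.le_ceil _
    have hr1 : (1 : ℝ) ≤ r := by exact_mod_cast hr
    have ha : |a| ≤ B := by
      have h1 := (hle _ 0).trans hwR
      rw [← le_div_iff₀' hκ] at h1
      have h2 : |(a : ℝ)| ≤ |(r : ℝ) * a| := by
        rw [abs_mul, Nat.abs_cast]; nlinarith [abs_nonneg (a : ℝ)]
      have h3 : |(a : ℝ)| ≤ B := h2.trans (h1.trans hB)
      exact_mod_cast h3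
    have hb : |b| ≤ B := by
      have h1 := (hle _ 1).trans hwR
      rw [← le_div_iff₀' hκ] at h1
      have h3 : |(b : ℝ)| ≤ B := h1.trans hB
      exact_mod_cast h3
    exact ⟨(a, b), by
      have h1 := abs_le.1 ha
      have h2 := abs_le.1 hb
      simp [h1, h2], rfl⟩
  obtain ⟨u, hu, hmin⟩ := S.exists_min_image (normA A) hfin ⟨_, he, he0, le_rfl⟩
  refine ⟨u, hu.1, hu.2.1, fun w hw hw0 => ?_⟩
  by_cases h : normA A w ≤ R
  · exact hmin w ⟨hw, hw0, h⟩
  · exact hu.2.2.trans (not_le.1 h).le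

theorem s1_eq_of_shortest {r : ℕ} {A : GL (Fin 2) ℝ} {u : V0} (hu : u ∈ baseLattice r)
    (hu0 : u ≠ 0) (hmin : ∀ w ∈ baseLattice r, w ≠ 0 → normA A u ≤ normA A w) :
    s1 r A = ENNReal.ofReal (normA A u) :=
  le_antisymm ((iInf_le _ u).trans ((iInf_le _ hu).trans (iInf_le _ hu0)))
    (le_iInf fun w => le_iInf fun hw => le_iInf fun hw0 => ENNReal.ofReal_le_ofReal (hmin w hw hw0))

theorem closure_pair_eq_baseLattice {r : ℕ} {a b c d : ℤ} (h : (a * d - b * c) ^ 2 = 1) :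
    AddSubgroup.closure {![(r : ℝ) * a, (b : ℝ)], ![(r : ℝ) * c, (d : ℝ)]} = baseLattice r := by
  refine le_antisymm ?_ fun w hw => ?_
  · rw [AddSubgroup.closure_le]
    rintro w (rfl | rfl)
    · exact mem_baseLattice.2 ⟨a, b, rfl⟩
    · exact mem_baseLattice.2 ⟨c, d, rfl⟩
  · obtain ⟨p, q, rfl⟩ := mem_baseLattice.1 hw
    rw [AddSubgroup.mem_closure_pair]
    have h' : ((a : ℝ) * d - b * c) ^ 2 = 1 := by exact_mod_cast h
    -- Cramer's rule; the determinant is its own inverse because its square is 1.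
    refine ⟨(a * d - b * c) * (p * d - q * c), (a * d - b * c) * (a * q - b * p), ?_⟩
    ext i
    fin_cases i
    · simp
      linear_combination (r * p : ℝ) * h'
    · simp
      linear_combination (q : ℝ) * h'

theorem normA_sub_sq (A : GL (Fin 2) ℝ) (u v : V0) :
    normA A (u - v) ^ 2 = normA A u ^ 2 - 2 * inner ℝ (toEuc A u) (toEuc A v) + normA A v ^ 2 := by
  rw [normA_eq, map_sub, norm_sub_sq_real, normA_eq, normA_eq]

/-- A Gauss reduced basis of the base lattice. -/
theorem exists_reduced_basis {r : ℕ} (hr : 0 < r) (A : GL (Fin 2) ℝ) : ∃ u v : V0,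
    u ∈ baseLattice r ∧ u ≠ 0 ∧ (∀ w ∈ baseLattice r, w ≠ 0 → normA A u ≤ normA A w) ∧
    AddSubgroup.closure {u, v} = baseLattice r ∧ AddSubgroup.closure {u, -v} = baseLattice r ∧
    normA A u ≤ normA A v ∧ omega u v = r ∧
    |inner ℝ (toEuc A u) (toEuc A v)| ≤ normA A u ^ 2 / 2 := by
  obtain ⟨u, hu, hu0, hmin⟩ := exists_shortest hr A
  have hpos := normA_pos A hu0
  have hr' : (r : ℝ) ≠ 0 := by exact_mod_cast hr.ne'
  obtain ⟨a, b, rfl⟩ := mem_baseLattice.1 hu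
  -- A shortest vector is primitive: dividing it by the gcd of its coordinates would give a shorter
  -- one.
  have hcop : IsCoprime a b := by
    rw [Int.isCoprime_iff_gcd_eq_one]
    set g := Int.gcd a b
    obtain ⟨a', ha'⟩ : (g : ℤ) ∣ a := Int.gcd_dvd_left ..
    obtain ⟨b', hb'⟩ : (g : ℤ) ∣ b := Int.gcd_dvd_right ..
    have e : ![(r : ℝ) * a, (b : ℝ)] = (g : ℝ) • ![(r : ℝ) * a', (b' : ℝ)] := by
      have h1 : (a : ℝ) = g * a' := by exact_mod_cast ha'
      have h2 : (b : ℝ) = g * b' := by exact_mod_cast hb'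
      ext i
      fin_cases i
      · simp [h1]; ring
      · simp [h2]
    have hw0 : ![(r : ℝ) * a', (b' : ℝ)] ≠ 0 := fun h => hu0 (by rw [e, h, smul_zero])
    have h1 := hmin _ (mem_baseLattice.2 ⟨a', b', rfl⟩) hw0
    have hwpos := normA_pos A hw0
    have h2 : (g : ℝ) ≤ 1 := by
      rw [e, normA_smul, Nat.abs_cast] at h1
      by_contra hg
      nlinarith
    have h3 : g ≠ 0 := fun h => hu0 (by rw [e, h]; simp)
    have h4 : g ≤ 1 := by exact_mod_cast h2
    omega
  obtain ⟨s, t, hst⟩ := hcop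
  set u := ![(r : ℝ) * a, (b : ℝ)] with hu_def
  -- The Bézout vector (-rt, s) completes u to a basis. Subtracting the nearest integer multiple of
  -- u brings the inner product below half of ‖u‖².
  set n := round (inner ℝ (toEuc A u) (toEuc A ![(r : ℝ) * (-t : ℤ), (s : ℝ)]) / normA A u ^ 2)
  have hdet : a * (s - n * b) - b * (-t - n * a) = 1 := by linear_combination hst
  have hv : ![(r : ℝ) * ((-t - n * a : ℤ) : ℝ), ((s - n * b : ℤ) : ℝ)]
      = ![(r : ℝ) * (-t : ℤ), (s : ℝ)] - (n : ℝ) • u := by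
    ext i
    fin_cases i
    · simp [hu_def]; ring
    · simp [hu_def]
  have hom : omega u ![(r : ℝ) * ((-t - n * a : ℤ) : ℝ), ((s - n * b : ℤ) : ℝ)] = r := by
    have h' : (a : ℝ) * (s - n * b) - b * (-t - n * a) = 1 := by exact_mod_cast hdet
    simp [omega, hu_def]
    linear_combination (r : ℝ) * h'
  have hv0 : ![(r : ℝ) * ((-t - n * a : ℤ) : ℝ), ((s - n * b : ℤ) : ℝ)] ≠ 0 := fun h => hr' <| by
    rw [← hom, h]; simp [omega]
  refine ⟨u, ![(r : ℝ) * ((-t - n * a : ℤ) : ℝ), ((s - n * b : ℤ) : ℝ)], hu, hu0, hmin,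
    closure_pair_eq_baseLattice (by rw [hdet]; norm_num), ?_,
    hmin _ (mem_baseLattice.2 ⟨_, _, rfl⟩) hv0, hom, ?_⟩
  · have := closure_pair_eq_baseLattice (r := r) (a := a) (b := b) (c := -(-t - n * a))
      (d := -(s - n * b)) (by linear_combination (a * (s - n * b) - b * (-t - n * a) + 1) * hdet)
    rw [← this]
    congr 3
    ext i
    fin_cases i
    · simp; ring
    · simp
  · rw [hv, map_sub, map_smul, inner_sub_right, inner_smul_right, real_inner_self_eq_norm_sq,
      ← normA_eq]
    have h1 := abs_sub_round (inner ℝ (toEuc A u) (toEuc A ![(r : ℝ) * (-t : ℤ), (s : ℝ)])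
      / normA A u ^ 2)
    have hsq : 0 < normA A u ^ 2 := by positivity
    have h2 : inner ℝ (toEuc A u) (toEuc A ![(r : ℝ) * (-t : ℤ), (s : ℝ)]) - n * normA A u ^ 2
        = (inner ℝ (toEuc A u) (toEuc A ![(r : ℝ) * (-t : ℤ), (s : ℝ)]) / normA A u ^ 2 - n)
          * normA A u ^ 2 := by field_simp
    rw [h2, abs_mul, abs_of_pos hsq]
    calc _ ≤ 1 / 2 * normA A u ^ 2 := by gcongr
      _ = _ := by ring

/-! ## The systolic inequality of flat tori -/

theorem Ctilde2_sq : Ctilde2 ^ 2 = 2 / √3 := Real.sq_sqrt (by positivity)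

theorem Ctilde2_pos : 0 < Ctilde2 := Real.sqrt_pos.2 (by positivity)

/-- C̃₂⁴ = 4/3; comparing fourth powers removes all nested roots. -/
theorem Ctilde2_mul_sqrt_pow_four {x : ℝ} (hx : 0 ≤ x) :
    3 * (Ctilde2 * √x) ^ 4 = 4 * x ^ 2 := by
  have h3 : √(3 : ℝ) ^ 2 = 3 := Real.sq_sqrt (by norm_num)
  have e : (Ctilde2 * √x) ^ 4 = (Ctilde2 ^ 2) ^ 2 * (√x ^ 2) ^ 2 := by ring
  rw [e, Ctilde2_sq, Real.sq_sqrt hx, div_pow, h3]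
  ring

theorem le_Ctilde2_mul_sqrt_iff {l x : ℝ} (hl : 0 ≤ l) (hx : 0 ≤ x) :
    l ≤ Ctilde2 * √x ↔ 3 * l ^ 4 ≤ 4 * x ^ 2 := by
  have hC := Ctilde2_pos
  rw [← Ctilde2_mul_sqrt_pow_four hx, mul_le_mul_iff_right₀ (by norm_num),
    pow_le_pow_iff_left₀ hl (by positivity) (by norm_num)]

theorem eq_Ctilde2_mul_sqrt_iff {l x : ℝ} (hl : 0 ≤ l) (hx : 0 ≤ x) :
    l = Ctilde2 * √x ↔ 3 * l ^ 4 = 4 * x ^ 2 := by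
  have hC := Ctilde2_pos
  rw [← Ctilde2_mul_sqrt_pow_four hx, mul_right_inj' (by norm_num),
    pow_left_inj₀ hl (by positivity) (by norm_num)]

theorem ofReal_Ctilde2_mul_torusArea {r : ℕ} (hr : 0 < r) (A : GL (Fin 2) ℝ) :
    ENNReal.ofReal Ctilde2 * torusArea r A ^ (1 / 2 : ℝ)
      = ENNReal.ofReal (Ctilde2 * √(r / absDet A)) := by
  have hD := absDet_pos A
  rw [torusArea_eq hr, ENNReal.ofReal_rpow_of_nonneg (by positivity) (by norm_num),
    ← ENNReal.ofReal_mul Ctilde2_pos.le, Real.sqrt_eq_rpow]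

/-- For a reduced basis, area² = ‖u‖²‖v‖² - ⟨u,v⟩² ≥ ‖u‖⁴ - ‖u‖⁴/4. -/
theorem s1_le {r : ℕ} (hr : 0 < r) (A : GL (Fin 2) ℝ) :
    s1 r A ≤ ENNReal.ofReal (Ctilde2 * √(r / absDet A)) := by
  have hD := absDet_pos A
  obtain ⟨u, v, hu, hu0, hmin, -, -, huv, hom, hin⟩ := exists_reduced_basis hr A
  rw [s1_eq_of_shortest hu hu0 hmin]
  have h0 := normA_nonneg A u
  refine ENNReal.ofReal_le_ofReal ((le_Ctilde2_mul_sqrt_iff h0 (by positivity)).2 ?_)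
  have h1 := sq_omega_add_sq_inner A u v
  rw [hom] at h1
  have h2 : normA A u ^ 2 ≤ normA A v ^ 2 := by gcongr
  have h3 := sq_le_sq' (neg_le_of_abs_le hin) (le_of_abs_le hin)
  rw [div_pow, h1, mul_div_cancel_left₀ _ (by positivity)]
  nlinarith [sq_nonneg (normA A u)]

theorem s1_eq_iff_isHexagonal {r : ℕ} (hr : 0 < r) (A : GL (Fin 2) ℝ) :
    s1 r A = ENNReal.ofReal (Ctilde2 * √(r / absDet A)) ↔ IsHexagonal r A := by
  have hD := absDet_pos A
  have hC := Ctilde2_pos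
  have hr' : (r : ℝ) ≠ 0 := by exact_mod_cast hr.ne'
  constructor
  · intro h
    obtain ⟨u, v, hu, hu0, hmin, hcl, hcl', huv, hom, hin⟩ := exists_reduced_basis hr A
    have h0 := normA_pos A hu0
    have hv0 := normA_nonneg A v
    rw [s1_eq_of_shortest hu hu0 hmin, ENNReal.ofReal_eq_ofReal_iff h0.le (by positivity),
      eq_Ctilde2_mul_sqrt_iff h0.le (by positivity)] at h
    have h1 := sq_omega_add_sq_inner A u v
    rw [hom] at h1
    rw [div_pow, h1, mul_div_cancel_left₀ _ (by positivity)] at h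
    have h2 : normA A u ^ 2 ≤ normA A v ^ 2 := by gcongr
    have h3 := sq_le_sq' (neg_le_of_abs_le hin) (le_of_abs_le hin)
    have hsq : 0 < normA A u ^ 2 := by positivity
    -- Equality in the area estimate forces both ‖v‖ = ‖u‖ and |⟨u,v⟩| = ‖u‖²/2. If the inner
    -- product is negative, v is replaced by -v.
    have h4 : normA A v ^ 2 = normA A u ^ 2 := by
      refine le_antisymm ?_ h2
      have : normA A u ^ 2 * normA A v ^ 2 ≤ normA A u ^ 2 * normA A u ^ 2 := by nlinarith
      exact le_of_mul_le_mul_left this hsq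
    have h5 : normA A u = normA A v := (pow_left_inj₀ h0.le hv0 two_ne_zero).1 h4.symm
    have h6 : inner ℝ (toEuc A u) (toEuc A v) ^ 2 = (normA A u ^ 2 / 2) ^ 2 := by
      rw [h4] at h; linarith
    rcases sq_eq_sq_iff_eq_or_eq_neg.1 h6 with h7 | h7
    · refine ⟨u, v, hcl, h5, (pow_left_inj₀ (normA_nonneg A _) h0.le two_ne_zero).1 ?_⟩
      rw [normA_sub_sq, h7, h4]; ring
    · refine ⟨u, -v, hcl', by rw [normA_neg, h5],
        (pow_left_inj₀ (normA_nonneg A _) h0.le two_ne_zero).1 ?_⟩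
      rw [normA_sub_sq, map_neg, inner_neg_right, h7, normA_neg, h4]; ring
  · rintro ⟨u, v, hcl, huv, huv'⟩
    have hu : u ∈ baseLattice r := hcl ▸ AddSubgroup.subset_closure (by simp)
    have hv : v ∈ baseLattice r := hcl ▸ AddSubgroup.subset_closure (by simp)
    have hin : inner ℝ (toEuc A u) (toEuc A v) = normA A u ^ 2 / 2 := by
      have := normA_sub_sq A u v
      rw [huv', ← huv] at this
      linarith
    -- Expressing the standard generators through u and v yields an integer matrix inverse to that
    -- of (u, v), so its determinant is ±1.
    have hom : omega u v ^ 2 = r ^ 2 := by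
      have h1 : ![(r : ℝ), 0] ∈ AddSubgroup.closure {u, v} :=
        hcl ▸ mem_baseLattice.2 ⟨1, 0, by simp⟩
      have h2 : ![(0 : ℝ), 1] ∈ AddSubgroup.closure {u, v} :=
        hcl ▸ mem_baseLattice.2 ⟨0, 1, by simp⟩
      obtain ⟨m, n, h1⟩ := AddSubgroup.mem_closure_pair.1 h1
      obtain ⟨m', n', h2⟩ := AddSubgroup.mem_closure_pair.1 h2
      obtain ⟨a, b, rfl⟩ := mem_baseLattice.1 hu
      obtain ⟨c, d, rfl⟩ := mem_baseLattice.1 hv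
      have h10 := congrFun h1 0
      have h11 := congrFun h1 1
      have h20 := congrFun h2 0
      have h21 := congrFun h2 1
      simp at h10 h11 h20 h21
      have e10 : (m : ℝ) * a + n * c = 1 := by
        apply mul_left_cancel₀ hr'; linear_combination h10
      have e20 : (m' : ℝ) * a + n' * c = 0 := by
        apply mul_left_cancel₀ hr'; linear_combination h20
      have hprod : ((m : ℝ) * n' - n * m') * (a * d - b * c) = 1 := by
        linear_combination (m' * b + n' * d : ℝ) * e10 + h21 - (m * b + n * d : ℝ) * e20
      have hprod' : (m * n' - n * m') * (a * d - b * c) = 1 := by exact_mod_cast hprod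
      have hdet : (a * d - b * c) ^ 2 = 1 := by
        rcases Int.mul_eq_one_iff_eq_one_or_neg_one.1 hprod' with ⟨-, h⟩ | ⟨-, h⟩ <;> rw [h] <;> rfl
      have hdet' : ((a : ℝ) * d - b * c) ^ 2 = 1 := by exact_mod_cast hdet
      simp only [omega, Matrix.cons_val_zero, Matrix.cons_val_one]
      linear_combination (r : ℝ) ^ 2 * hdet'
    have hu0 : u ≠ 0 := by
      rintro rfl
      simp [omega] at hom
      exact hr' (pow_eq_zero_iff two_ne_zero |>.1 hom.symm)
    have h0 := normA_pos A hu0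
    have hmin : ∀ w ∈ baseLattice r, w ≠ 0 → normA A u ≤ normA A w := by
      intro w hw hw0
      rw [← hcl] at hw
      obtain ⟨m, n, rfl⟩ := AddSubgroup.mem_closure_pair.1 hw
      refine (pow_le_pow_iff_left₀ h0.le (normA_nonneg A _) two_ne_zero).1 ?_
      -- In a hexagonal basis the squared norm is ‖u‖² times m² + mn + n², a positive definite
      -- integral form, hence at least ‖u‖² off the origin.
      have e : normA A (m • u + n • v) ^ 2 = normA A u ^ 2 * ((m ^ 2 + m * n + n ^ 2 : ℤ) : ℝ) := by
        have h := normA_sub_sq A (m • u) (-(n • v))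
        rw [sub_neg_eq_add, ← Int.cast_smul_eq_zsmul ℝ, ← Int.cast_smul_eq_zsmul ℝ n, normA_neg,
          normA_smul, normA_smul, map_neg, map_smul, map_smul, inner_neg_right, inner_smul_left,
          inner_smul_right, hin, mul_pow, mul_pow, sq_abs, sq_abs, ← huv] at h
        rw [← Int.cast_smul_eq_zsmul ℝ, ← Int.cast_smul_eq_zsmul ℝ n, h]
        simp
        ring
      have h1 : (1 : ℤ) ≤ m ^ 2 + m * n + n ^ 2 := by
        by_contra hlt
        have h2 : m ^ 2 + m * n + n ^ 2 ≤ 0 := by omega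
        have hm : m = 0 := by
          have : m ^ 2 ≤ 0 := by nlinarith [sq_nonneg (m + 2 * n), sq_nonneg m]
          exact pow_eq_zero_iff two_ne_zero |>.1 (le_antisymm this (sq_nonneg m))
        have hn : n = 0 := by
          have : n ^ 2 ≤ 0 := by rw [hm] at h2; nlinarith
          exact pow_eq_zero_iff two_ne_zero |>.1 (le_antisymm this (sq_nonneg n))
        exact hw0 (by simp [hm, hn])
      have h1' : (1 : ℝ) ≤ ((m ^ 2 + m * n + n ^ 2 : ℤ) : ℝ) := by exact_mod_cast h1
      rw [e]
      exact le_mul_of_one_le_right (by positivity) h1'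
    rw [s1_eq_of_shortest hu hu0 hmin, ENNReal.ofReal_eq_ofReal_iff h0.le (by positivity),
      eq_Ctilde2_mul_sqrt_iff h0.le (by positivity), div_pow, ← hom, sq_omega_add_sq_inner A,
      mul_div_cancel_left₀ _ (by positivity), hin, ← huv]
    ring

theorem exists_isHexagonal {r : ℕ} (hr : 0 < r) : ∃ A : GL (Fin 2) ℝ, IsHexagonal r A := by
  have hr' : (r : ℝ) ≠ 0 := by exact_mod_cast hr.ne'
  have h3 : √(3 : ℝ) ^ 2 = 3 := Real.sq_sqrt (by norm_num)
  -- N sends rX to (1, 0) and Y to (1/2, √3/2), two sides of an equilateral triangle. As `normA`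
  -- applies A⁻¹, the matrix A is N⁻¹.
  set N : Matrix (Fin 2) (Fin 2) ℝ := !![1 / r, 1 / 2; 0, √3 / 2] with hN
  have hdet : N.det ≠ 0 := by simp [hN, Matrix.det_fin_two_of, hr']
  set A : GL (Fin 2) ℝ := (Matrix.GeneralLinearGroup.mkOfDetNeZero N hdet)⁻¹ with hA
  have hT : ∀ u : V0, normA A u ^ 2 = (u 0 / r + u 1 / 2) ^ 2 + (√3 / 2 * u 1) ^ 2 := fun u => by
    have hco : ((A⁻¹ : GL (Fin 2) ℝ) : Matrix (Fin 2) (Fin 2) ℝ) = N := by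
      rw [hA, inv_inv]; rfl
    rw [normA_sq, toEuc_apply, toEuc_apply, hco]
    simp [hN, Matrix.mulVec, dotProduct, Fin.sum_univ_two]
    ring
  have h1 : ∀ u : V0, normA A u ^ 2 = 1 → normA A u = 1 := fun u hu =>
    (pow_eq_one_iff_of_nonneg (normA_nonneg A u) two_ne_zero).1 hu
  have hu : normA A ![(r : ℝ) * (1 : ℤ), ((0 : ℤ) : ℝ)] = 1 := h1 _ (by rw [hT]; simp [hr'])
  have hv : normA A ![(r : ℝ) * (0 : ℤ), ((1 : ℤ) : ℝ)] = 1 := h1 _ (by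
    rw [hT]; simp; rw [div_pow, h3]; norm_num)
  refine ⟨A, _, _, closure_pair_eq_baseLattice (a := 1) (b := 0) (c := 0) (d := 1) (by norm_num),
    hu.trans hv.symm, (h1 _ ?_).trans hu.symm⟩
  rw [hT]
  simp [hr']
  rw [div_pow, h3]
  norm_num

/-! ## The systolic inequality -/

theorem le_four_pi_div_iff {r : ℝ} : r ≤ 4 * Real.pi / Ctilde2 ^ 2 ↔ Ctilde2 ^ 2 * r ≤ 4 * Real.pi := by
  rw [le_div_iff₀' (pow_pos Ctilde2_pos 2)]

theorem four_pi_div_le_iff {r : ℝ} : 4 * Real.pi / Ctilde2 ^ 2 ≤ r ↔ 4 * Real.pi ≤ Ctilde2 ^ 2 * r := by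
  rw [div_le_iff₀' (pow_pos Ctilde2_pos 2)]

theorem Ctilde2_mul_sqrt_le_iff {r D : ℝ} (hr : 0 ≤ r) (hD : 0 < D) :
    Ctilde2 * √(r / D) ≤ 2 * √(Real.pi / D) ↔ Ctilde2 ^ 2 * r ≤ 4 * Real.pi := by
  have hC := Ctilde2_pos
  have hpi := Real.pi_pos
  rw [← pow_le_pow_iff_left₀ (by positivity) (by positivity) two_ne_zero, mul_pow, mul_pow,
    Real.sq_sqrt (by positivity), Real.sq_sqrt (by positivity), ← mul_div_assoc, ← mul_div_assoc,
    div_le_div_iff_of_pos_right hD]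
  norm_num

theorem two_mul_sqrt_le_Ctilde2_mul_sqrt_iff {r D : ℝ} (hr : 0 ≤ r) (hD : 0 < D) :
    2 * √(Real.pi / D) ≤ Ctilde2 * √(r / D) ↔ 4 * Real.pi ≤ Ctilde2 ^ 2 * r := by
  have hC := Ctilde2_pos
  have hpi := Real.pi_pos
  rw [← pow_le_pow_iff_left₀ (by positivity) (by positivity) two_ne_zero, mul_pow, mul_pow,
    Real.sq_sqrt (by positivity), Real.sq_sqrt (by positivity), ← mul_div_assoc, ← mul_div_assoc,
    div_le_div_iff_of_pos_right hD]
  norm_num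

/-- The threshold exceeds 2, so in the second case the fibre class is automatically nonzero in
homology. -/
theorem two_le_of_four_pi_div_le {r : ℕ} (h : 4 * Real.pi / Ctilde2 ^ 2 ≤ (r : ℝ)) : 2 ≤ r := by
  rw [four_pi_div_le_iff, Ctilde2_sq, div_mul_eq_mul_div, le_div_iff₀ (by positivity)] at h
  have h1 := Real.pi_gt_three
  have h2 : (1 : ℝ) ≤ √3 := Real.one_le_sqrt.2 (by norm_num)
  have h3 : (2 : ℝ) < r := by nlinarith
  have : 2 < r := by exact_mod_cast h3
  exact this.le

theorem rpow_quarter_volume {r D : ℝ} (hr : 0 ≤ r) (hD : 0 < D) :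
    (r / D ^ 2) ^ (1 / 4 : ℝ) = r ^ (1 / 4 : ℝ) / √D := by
  rw [Real.div_rpow hr (by positivity), Real.sqrt_eq_rpow, ← Real.rpow_natCast, ← Real.rpow_mul hD.le]
  norm_num

theorem ofReal_mul_poppVol {r : ℕ} (hr : 0 < r) (A : GL (Fin 2) ℝ) {C : ℝ} (hC : 0 ≤ C) :
    ENNReal.ofReal C * poppVol r A ^ (1 / 4 : ℝ)
      = ENNReal.ofReal (C * ((r : ℝ) ^ (1 / 4 : ℝ) / √(absDet A))) := by
  have hD := absDet_pos A
  rw [poppVol_eq hr, ENNReal.ofReal_rpow_of_nonneg (by positivity) (by norm_num),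
    ← ENNReal.ofReal_mul hC, rpow_quarter_volume (by positivity) hD]

theorem systolic_bound_small {r : ℕ} (hr : 0 < r) (A : GL (Fin 2) ℝ) :
    ENNReal.ofReal (Ctilde2 * (r : ℝ) ^ (1 / 4 : ℝ)) * poppVol r A ^ (1 / 4 : ℝ)
      = ENNReal.ofReal (Ctilde2 * √(r / absDet A)) := by
  have hC := Ctilde2_pos
  have hr' : (0 : ℝ) ≤ r := by positivity
  rw [ofReal_mul_poppVol hr A (by positivity), mul_assoc, ← mul_div_assoc,
    Real.sqrt_div hr', Real.sqrt_eq_rpow (r : ℝ), ← Real.rpow_add (by exact_mod_cast hr)]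
  norm_num

/-- An identity for every A: the bound of the second case is s₂ itself, so its equality case is that
the systole equals s₂. -/
theorem systolic_bound_large {r : ℕ} (hr : 0 < r) (A : GL (Fin 2) ℝ) :
    ENNReal.ofReal (2 * √Real.pi / (r : ℝ) ^ (1 / 4 : ℝ)) * poppVol r A ^ (1 / 4 : ℝ) = s2 A := by
  have hr' : (0 : ℝ) < (r : ℝ) ^ (1 / 4 : ℝ) := Real.rpow_pos_of_pos (by exact_mod_cast hr) _
  rw [ofReal_mul_poppVol hr A (by positivity), s2_eq, Real.sqrt_div Real.pi_pos.le]
  congr 1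
  field_simp

theorem heisSystole_eq_min {r : ℕ} (hr : 2 ≤ r) (A : GL (Fin 2) ℝ) :
    heisSystole r A = min (s1 r A) (s2 A) :=
  le_antisymm (le_min (heisSystole_le_s1 (by omega) A) (heisSystole_le_s2 hr A))
    (min_le_heisSystole (by omega) A)

/-- The inequality s₁ ≤ s₂ makes the upper bound by s₂ unnecessary. This covers r = 1, where the
fibre is null-homologous. -/
theorem heisSystole_eq_s1 {r : ℕ} (hr : 0 < r) (h : (r : ℝ) ≤ 4 * Real.pi / Ctilde2 ^ 2)
    (A : GL (Fin 2) ℝ) : heisSystole r A = s1 r A := by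
  refine le_antisymm (heisSystole_le_s1 hr A) ?_
  have h1 : s1 r A ≤ s2 A := (s1_le hr A).trans <| by
    rw [s2_eq]
    exact ENNReal.ofReal_le_ofReal ((Ctilde2_mul_sqrt_le_iff (by positivity) (absDet_pos A)).2
      (le_four_pi_div_iff.1 h))
  simpa [h1] using min_le_heisSystole hr A

end SubRiem

end

open SubRiem
theorem theoremA2 (r : ℕ) (hr : 0 < r) :
    ((r : ℝ) ≤ 4 * Real.pi / Ctilde2 ^ 2 →
      (∀ A : GL (Fin 2) ℝ,
        heisSystole r A = s1 r A ∧
        heisSystole r A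
          ≤ ENNReal.ofReal (Ctilde2 * (r : ℝ) ^ (1 / 4 : ℝ)) * poppVol r A ^ (1 / 4 : ℝ) ∧
        (heisSystole r A
            = ENNReal.ofReal (Ctilde2 * (r : ℝ) ^ (1 / 4 : ℝ)) * poppVol r A ^ (1 / 4 : ℝ) ↔
          s1 r A = ENNReal.ofReal Ctilde2 * torusArea r A ^ (1 / 2 : ℝ)) ∧
        (s1 r A = ENNReal.ofReal Ctilde2 * torusArea r A ^ (1 / 2 : ℝ) ↔ IsHexagonal r A)) ∧
      (∃ A : GL (Fin 2) ℝ, heisSystole r A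
          = ENNReal.ofReal (Ctilde2 * (r : ℝ) ^ (1 / 4 : ℝ)) * poppVol r A ^ (1 / 4 : ℝ))) ∧
    (4 * Real.pi / Ctilde2 ^ 2 ≤ (r : ℝ) →
      (∀ A : GL (Fin 2) ℝ,
        heisSystole r A
          ≤ ENNReal.ofReal (2 * √Real.pi / (r : ℝ) ^ (1 / 4 : ℝ)) * poppVol r A ^ (1 / 4 : ℝ) ∧
        (heisSystole r A
            = ENNReal.ofReal (2 * √Real.pi / (r : ℝ) ^ (1 / 4 : ℝ)) * poppVol r A ^ (1 / 4 : ℝ) ↔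
          s2 A ≤ s1 r A) ∧
        (s2 A ≤ s1 r A ↔ heisSystole r A = s2 A)) ∧
      (∃ A : GL (Fin 2) ℝ, heisSystole r A
          = ENNReal.ofReal (2 * √Real.pi / (r : ℝ) ^ (1 / 4 : ℝ)) * poppVol r A ^ (1 / 4 : ℝ))) := by
  -- A hexagonal base is extremal in both cases: it attains the flat bound in the first, and in the
  -- second its s₁ is large enough to reach s₂.
  obtain ⟨A₀, hA₀⟩ := exists_isHexagonal hr
  have hA₁ := (s1_eq_iff_isHexagonal hr A₀).2 hA₀
  refine ⟨fun h => ⟨fun A => ?_, A₀, ?_⟩, fun h => ?_⟩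
  · rw [heisSystole_eq_s1 hr h, systolic_bound_small hr, ofReal_Ctilde2_mul_torusArea hr]
    exact ⟨rfl, s1_le hr A, Iff.rfl, s1_eq_iff_isHexagonal hr A⟩
  · rw [heisSystole_eq_s1 hr h, systolic_bound_small hr, hA₁]
  · have h2 := two_le_of_four_pi_div_le h
    have hmin : ∀ A, s2 A ≤ s1 r A ↔ heisSystole r A = s2 A := fun A => by
      rw [heisSystole_eq_min h2, min_eq_right_iff]
    refine ⟨fun A => ?_, A₀, ?_⟩
    · rw [systolic_bound_large hr]
      exact ⟨heisSystole_le_s2 h2 A, (hmin A).symm, hmin A⟩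
    · rw [systolic_bound_large hr, ← hmin, hA₁, s2_eq]
      exact ENNReal.ofReal_le_ofReal ((two_mul_sqrt_le_Ctilde2_mul_sqrt_iff (by positivity) (absDet_pos A₀)).2
        (four_pi_div_le_iff.1 h))
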